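/- **Setting.** Let $M$ be a smooth manifold of dimension $n\ge 1$. An *Aristotelian structure* on $M$ is a quadruple $(\tau,Z,\gamma,h)$ of a smooth one-form $\tau$, a smooth vector field $Z$ with $\tau(Z)=1$, a smooth symmetric positive semi-definite contravariant two-tensor $\gamma$ with kernel spanned by $\tau$, and a smooth symmetric positive semi-definite covariant two-tensor $h$ with kernel spanned by $Z$. It is *integrable* if $\tau\wedge \mathrm d\tau=0$. Let $$\mathsf G_{\mathtt A}=\Big\{\begin{pmatrix}1&0\\0&\mathsf A\end{pmatrix}\ \Big|\ \mathsf A\in \mathsf O(n-1)\Big\}\subset \mathsf{GL}(n,\mathbb R),$$ with Lie algebra $\mathfrak g_{\mathtt A}$. A $\mathsf G_{\mathtt A}$-structure is a principal $\mathsf G_{\mathtt A}$-subbundle $\pi\colon P\to M$ of the frame bundle of $M$, so that each $u\in P$ is a frame $u\colon\mathbb R^n\to T_{\pi(u)}M$. It *induces* $(\tau,Z,\gamma,h)$ if every $u\in P$ takes $\mathrm{pr}_1$, $e_1$, $\sum_{a\ge 2}e_a\otimes e_a$ and $\sum_{a\ge2}e^a\otimes e^a$ to the values of $\tau$, $Z$,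 $\gamma$ and $h$ at $\pi(u)$. It is *integrable* if $M$ is covered by charts whose coordinate frames belong to $P$. Let $\vartheta_u(X)=u^{-1}(\pi_*X)$ be the soldering form on $P$. For an Ehresmann (principal) connection $\omega\in\Omega^1(P,\mathfrak g_{\mathtt A})$ let $\Theta=\mathrm d\vartheta+\omega\wedge\vartheta$ be its torsion, $\bar\Theta$ the real two-form $\bar\Theta_u=\langle u(\Theta_u),\tau_{\pi(u)}\rangle$ on $P$, $\bar Z$ the horizontal lift of $Z$, and $\mathrm d^\omega\beta=(\mathrm d\beta)\circ\mathrm{hor}$ the covariant derivative, where $\mathrm{hor}$ is the projection onto $\ker\omega$ along the vertical subspaces. The *intrinsic torsion* of $P$ is the class of $\Theta$, viewed at each $u\in P$ via $\vartheta$ as an element of $\mathrm{Hom}(\Lambda^2\mathbb R^n,\mathbb R^n)$, modulo the image of $\partial\colon\mathrm{Hom}(\mathbb R^n,\mathfrak g_{\mathtt A})\to\mathrm{Hom}(\Lambda^2\mathbb R^n,\mathbb R^n)$, $(\partial\kappa)(v,w)=\kappa(v)w-\kappa(w)v$. For a smooth one-form $\alpha$ on $M$ with $\mathrm d\tau=\tau\wedge\alpha$,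 the three-form $\alpha\wedge\mathrm d\alpha$ is closed; $[\alpha\wedge\mathrm d\alpha]\in H^3(M;\mathbb R)$ is the *Godbillon–Vey class*. **Proposition.** Let $(\tau,Z,\gamma,h)$ be an integrable Aristotelian structure on $M$ induced by a $\mathsf G_{\mathtt A}$-structure $\pi\colon P\to M$, and let $\omega$ be an Ehresmann connection on $P$. 1. There is exactly one smooth one-form $\alpha$ on $M$ with $\mathrm d\tau=\tau\wedge\alpha$ and $\iota_Z\alpha=0$, and for it $$\pi^*(\alpha\wedge\mathrm d\alpha)=\iota_{\bar Z}\bar\Theta\wedge\mathrm d^\omega\,\iota_{\bar Z}\bar\Theta .$$ 2. If $\Theta=0$, or if only the intrinsic torsion of $P$ vanishes, then $[\alpha\wedge\mathrm d\alpha]=0$ for every smooth $\alpha$ with $\mathrm d\tau=\tau\wedge\alpha$. 3. If $[\alpha\wedge\mathrm d\alpha]\neq0$ for some smooth $\alpha$ with $\mathrm d\tau=\tau\wedge\alpha$, then $\Theta\ne0$, the intrinsic torsion of $P$ does not vanish, and the $\mathsf G_{\mathtt A}$-structure $P$ is not integrable. -/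

import Mathlib

open scoped Manifold ContDiff Topology

set_option linter.unusedSectionVars false

noncomputable section

namespace GodbillonVey

/-! ## Differential forms on manifolds

All manifolds are smooth, without boundary, and modelled on a real normed space `E`.  Mathlib's
tangent space `TangentSpace 𝓘(ℝ, E) x` is by definition `E` (through the preferred chart at `x`),
so an `F`-valued `k`-form on `M` is a family of alternating maps `E [⋀^Fin k]→L[ℝ] F` indexed by
the points of `M`. -/

section Forms

variable {E M F F' F'' : Type*}
  [NormedAddCommGroup E] [NormedSpace ℝ E] [TopologicalSpace M] [ChartedSpace E M]
  [NormedAddCommGroup F] [NormedSpace ℝ F] [NormedAddCommGroup F'] [NormedSpace ℝ F']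
  [NormedAddCommGroup F''] [NormedSpace ℝ F'']

/-- The tangent map `T_x M → T_{f x} N` of a map of manifolds. -/
abbrev differential {E' N : Type*} [NormedAddCommGroup E'] [NormedSpace ℝ E'] [TopologicalSpace N]
    [ChartedSpace E' N] (f : M → N) (x : M) : E →L[ℝ] E' :=
  mfderiv 𝓘(ℝ, E) 𝓘(ℝ, E') f x

/-- Families of alternating `k`-forms with values in `F` on the tangent spaces of `M`. -/
abbrev DiffForm (E M : Type*) [NormedAddCommGroup E] [NormedSpace ℝ E] (k : ℕ)
    (F : Type*) [NormedAddCommGroup F] [NormedSpace ℝ F] :=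
  M → E [⋀^Fin k]→L[ℝ] F

variable {k : ℕ}

/-- The coordinate expression of a form in the preferred chart at `x₀`, i.e. its pullback along
the inverse of that chart. -/
def inChart (β : DiffForm E M k F) (x₀ : M) : E → E [⋀^Fin k]→L[ℝ] F := fun y =>
  (β ((extChartAt 𝓘(ℝ, E) x₀).symm y)).compContinuousLinearMap
    (differential (extChartAt 𝓘(ℝ, E) x₀).symm y)

/-- A form is smooth if all its coordinate expressions are. -/
def IsSmooth (β : DiffForm E M k F) : Prop :=
  ∀ x₀ : M, ContDiffOn ℝ ∞ (inChart β x₀) (extChartAt 𝓘(ℝ, E) x₀).target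

/-- The exterior derivative, computed at `x` in the preferred chart at `x`; by `inChart_extD` it
is computed by `extDeriv` in every chart. The convention is
`dβ(X, Y) = X (β Y) - Y (β X) - β [X, Y]` for one-forms, without a factor `1/2`. -/
def extD (β : DiffForm E M k F) : DiffForm E M (k + 1) F := fun x =>
  (extDeriv (inChart β x) (extChartAt 𝓘(ℝ, E) x x)).compContinuousLinearMap
    (differential (E := E) (extChartAt 𝓘(ℝ, E) x) x)

/-- A one-form as a family of linear maps. -/
def toCovector (a : DiffForm E M 1 F) (x : M) : E →L[ℝ] F :=
  (ContinuousAlternatingMap.ofSubsingletonLIE (0 : Fin 1)).symm (a x)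

/-- The wedge product of a one-form and a `k`-form with respect to a bilinear pairing of their
values, `(a ∧ b)(v₀, …, v_k) = ∑ i, (-1)^i B (a v_i) (b (v₀, …, v̂_i, …, v_k))`. -/
def wedgeWith (B : F →L[ℝ] F' →L[ℝ] F'') (a : DiffForm E M 1 F) (b : DiffForm E M k F') :
    DiffForm E M (k + 1) F'' := fun x =>
  ContinuousAlternatingMap.alternatizeUncurryFin
    (((ContinuousLinearMap.compContinuousAlternatingMapCLM ℝ E F' F'' (Fin k)).flip (b x)) ∘L B ∘L
      toCovector a x)

/-- The wedge product of a real one-form and a real `k`-form. -/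
abbrev wedge (a : DiffForm E M 1 ℝ) (b : DiffForm E M k ℝ) : DiffForm E M (k + 1) ℝ :=
  wedgeWith (ContinuousLinearMap.mul ℝ ℝ) a b

/-- The interior product `ι_X β = β(X, …)`. -/
def interior (X : M → E) (β : DiffForm E M (k + 1) F) : DiffForm E M k F := fun x =>
  (β x).curryLeft (X x)

/-- The pullback `f^* β` of a form. -/
def pullback {E' N : Type*} [NormedAddCommGroup E'] [NormedSpace ℝ E'] [TopologicalSpace N]
    [ChartedSpace E' N] (f : N → M) (β : DiffForm E M k F) : DiffForm E' N k F := fun u =>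
  (β (f u)).compContinuousLinearMap (differential f u)

theorem wedgeWith_apply (B : F →L[ℝ] F' →L[ℝ] F'') (a : DiffForm E M 1 F) (b : DiffForm E M k F')
    (x : M) (v : Fin (k + 1) → E) :
    wedgeWith B a b x v =
      ∑ i : Fin (k + 1), (-1) ^ (i : ℕ) • B (a x fun _ => v i) (b x (i.removeNth v)) := by
  simp [wedgeWith, toCovector, ContinuousAlternatingMap.alternatizeUncurryFin_apply]

theorem inChart_wedgeWith (B : F →L[ℝ] F' →L[ℝ] F'') (a : DiffForm E M 1 F) (b : DiffForm E M k F')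
    (x₀ : M) : inChart (wedgeWith B a b) x₀ = wedgeWith B (inChart a x₀) (inChart b x₀) := by
  ext y v
  simp only [inChart, wedgeWith_apply, ContinuousAlternatingMap.compContinuousLinearMap_apply]
  rfl

theorem contDiffWithinAt_wedgeWith (B : F →L[ℝ] F' →L[ℝ] F'') {a : E → E [⋀^Fin 1]→L[ℝ] F}
    {b : E → E [⋀^Fin k]→L[ℝ] F'} {s : Set E} {y : E} (ha : ContDiffWithinAt ℝ ∞ a s y)
    (hb : ContDiffWithinAt ℝ ∞ b s y) : ContDiffWithinAt ℝ ∞ (wedgeWith B a b) s y := by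
  have hC : ContDiff ℝ ∞ fun L : E →L[ℝ] E [⋀^Fin k]→L[ℝ] F'' =>
      ContinuousAlternatingMap.alternatizeUncurryFinCLM ℝ E F'' L :=
    ContinuousLinearMap.contDiff _
  have hD : ContDiff ℝ ∞ fun L : E [⋀^Fin k]→L[ℝ] F' =>
      (ContinuousLinearMap.compContinuousAlternatingMapCLM ℝ E F' F'' (Fin k)).flip L :=
    ContinuousLinearMap.contDiff _
  have hO : ContDiff ℝ ∞ fun L : E [⋀^Fin 1]→L[ℝ] F =>
      ((ContinuousAlternatingMap.ofSubsingletonLIE (𝕜 := ℝ) (E := E) (F := F)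
        (0 : Fin 1)).symm L : E →L[ℝ] F) :=
    LinearIsometryEquiv.contDiff _
  exact hC.contDiffAt.comp_contDiffWithinAt y ((hD.contDiffAt.comp_contDiffWithinAt y hb).clm_comp
    (contDiffWithinAt_const.clm_comp (hO.contDiffAt.comp_contDiffWithinAt y ha)))

theorem IsSmooth.wedgeWith (B : F →L[ℝ] F' →L[ℝ] F'') {a : DiffForm E M 1 F} {b : DiffForm E M k F'}
    (ha : IsSmooth a) (hb : IsSmooth b) : IsSmooth (GodbillonVey.wedgeWith B a b) := by
  intro x₀
  rw [inChart_wedgeWith]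
  exact fun y hy => contDiffWithinAt_wedgeWith B (ha x₀ y hy) (hb x₀ y hy)

theorem inChart_add (β γ : DiffForm E M k F) (x₀ : M) :
    inChart (β + γ) x₀ = inChart β x₀ + inChart γ x₀ := by
  ext y v; simp [inChart]

theorem inChart_smul (c : ℝ) (β : DiffForm E M k F) (x₀ : M) :
    inChart (c • β) x₀ = c • inChart β x₀ := by
  ext y v; simp [inChart]

theorem IsSmooth.add {β γ : DiffForm E M k F} (hβ : IsSmooth β) (hγ : IsSmooth γ) :
    IsSmooth (β + γ) := fun x₀ => by
  rw [inChart_add]; exact (hβ x₀).add (hγ x₀)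

theorem IsSmooth.smul (c : ℝ) {β : DiffForm E M k F} (hβ : IsSmooth β) :
    IsSmooth (c • β) := fun x₀ => by
  rw [inChart_smul]; exact (hβ x₀).const_smul c

theorem isSmooth_zero : IsSmooth (0 : DiffForm E M k F) := fun x₀ => by
  have : inChart (0 : DiffForm E M k F) x₀ = 0 := by ext y v; simp [inChart]
  rw [this]; exact contDiffOn_const

theorem IsSmooth.contDiffAt {β : DiffForm E M k F} (hβ : IsSmooth β) (x₀ : M) {y : E}
    (hy : y ∈ (extChartAt 𝓘(ℝ, E) x₀).target) : ContDiffAt ℝ ∞ (inChart β x₀) y :=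
  (hβ x₀).contDiffAt ((isOpen_extChartAt_target (I := 𝓘(ℝ, E)) x₀).mem_nhds hy)

theorem IsSmooth.differentiableAt {β : DiffForm E M k F} (hβ : IsSmooth β) (x₀ : M) {y : E}
    (hy : y ∈ (extChartAt 𝓘(ℝ, E) x₀).target) : DifferentiableAt ℝ (inChart β x₀) y :=
  (hβ.contDiffAt x₀ hy).differentiableAt (by simp)

theorem extD_add {β γ : DiffForm E M k F} (hβ : IsSmooth β) (hγ : IsSmooth γ) :
    extD (β + γ) = extD β + extD γ := by
  funext x
  have hx := mem_extChartAt_target (I := 𝓘(ℝ, E)) x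
  simp only [extD, inChart_add, Pi.add_apply]
  rw [extDeriv_add (hβ.differentiableAt x hx) (hγ.differentiableAt x hx)]
  rfl

theorem extD_smul (c : ℝ) (β : DiffForm E M k F) : extD (c • β) = c • extD β := by
  funext x
  simp only [extD, inChart_smul, extDeriv_smul, Pi.smul_apply]
  rfl

theorem extD_zero : extD (0 : DiffForm E M k F) = 0 := by
  have := extD_smul 0 (0 : DiffForm E M k F)
  simpa using this

theorem two_le : minSmoothness ℝ 2 ≤ (∞ : WithTop ℕ∞) := by
  simp only [minSmoothness_of_isRCLikeNormedField]
  exact ENat.LEInfty.out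

variable [IsManifold 𝓘(ℝ, E) ∞ M]

theorem mdifferentiableAt_chart {x₁ x : M} (hx : x ∈ (extChartAt 𝓘(ℝ, E) x₁).source) :
    MDifferentiableAt 𝓘(ℝ, E) 𝓘(ℝ, E) (extChartAt 𝓘(ℝ, E) x₁) x :=
  (contMDiffAt_extChartAt' (n := ∞) (by simpa using hx)).mdifferentiableAt (by simp)

theorem contMDiffAt_chart_symm {x₀ : M} {y : E} (hy : y ∈ (extChartAt 𝓘(ℝ, E) x₀).target) :
    ContMDiffAt 𝓘(ℝ, E) 𝓘(ℝ, E) ∞ (extChartAt 𝓘(ℝ, E) x₀).symm y :=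
  (contMDiffOn_extChartAt_symm (n := ∞) x₀).contMDiffAt
    ((isOpen_extChartAt_target (I := 𝓘(ℝ, E)) x₀).mem_nhds hy)

theorem mdifferentiableAt_chart_symm {x₀ : M} {y : E}
    (hy : y ∈ (extChartAt 𝓘(ℝ, E) x₀).target) :
    MDifferentiableAt 𝓘(ℝ, E) 𝓘(ℝ, E) (extChartAt 𝓘(ℝ, E) x₀).symm y :=
  (contMDiffAt_chart_symm hy).mdifferentiableAt (by simp)

theorem contDiffAt_coordChange {x₀ x₁ : M} {y : E} (hy : y ∈ (extChartAt 𝓘(ℝ, E) x₀).target)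
    (hy' : (extChartAt 𝓘(ℝ, E) x₀).symm y ∈ (extChartAt 𝓘(ℝ, E) x₁).source) :
    ContDiffAt ℝ ∞ (extChartAt 𝓘(ℝ, E) x₁ ∘ (extChartAt 𝓘(ℝ, E) x₀).symm) y := by
  rw [← contMDiffAt_iff_contDiffAt]
  exact (contMDiffAt_extChartAt' (n := ∞) (by simpa using hy')).comp y (contMDiffAt_chart_symm hy)

theorem fderiv_coordChange {x₀ x₁ : M} {y : E} (hy : y ∈ (extChartAt 𝓘(ℝ, E) x₀).target)
    (hy' : (extChartAt 𝓘(ℝ, E) x₀).symm y ∈ (extChartAt 𝓘(ℝ, E) x₁).source) :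
    fderiv ℝ (extChartAt 𝓘(ℝ, E) x₁ ∘ (extChartAt 𝓘(ℝ, E) x₀).symm) y =
      differential (E := E) (extChartAt 𝓘(ℝ, E) x₁) ((extChartAt 𝓘(ℝ, E) x₀).symm y) ∘L
        differential (extChartAt 𝓘(ℝ, E) x₀).symm y := by
  rw [← mfderiv_eq_fderiv]
  exact mfderiv_comp y (mdifferentiableAt_chart hy') (mdifferentiableAt_chart_symm hy)

theorem differential_symm_comp {x₁ x : M} (hx : x ∈ (extChartAt 𝓘(ℝ, E) x₁).source) :
    differential (E := E) (E' := E) (extChartAt 𝓘(ℝ, E) x₁).symm (extChartAt 𝓘(ℝ, E) x₁ x) ∘L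
      differential (E := E) (E' := E) (extChartAt 𝓘(ℝ, E) x₁) x = ContinuousLinearMap.id ℝ E := by
  have h1 := mfderiv_comp x
    (mdifferentiableAt_chart_symm ((extChartAt 𝓘(ℝ, E) x₁).map_source hx))
    (mdifferentiableAt_chart hx)
  refine h1.symm.trans ?_
  have h2 : (extChartAt 𝓘(ℝ, E) x₁).symm ∘ (extChartAt 𝓘(ℝ, E) x₁) =ᶠ[𝓝 x] id := by
    filter_upwards [(isOpen_extChartAt_source (I := 𝓘(ℝ, E)) x₁).mem_nhds hx] with z hz
    exact (extChartAt 𝓘(ℝ, E) x₁).left_inv hz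
  rw [h2.mfderiv_eq]
  exact mfderiv_id

theorem inChart_coordChange (β : DiffForm E M k F) (x₀ x₁ : M) {y : E}
    (hy : y ∈ (extChartAt 𝓘(ℝ, E) x₀).target)
    (hy' : (extChartAt 𝓘(ℝ, E) x₀).symm y ∈ (extChartAt 𝓘(ℝ, E) x₁).source) :
    inChart β x₀ y =
      (inChart β x₁ ((extChartAt 𝓘(ℝ, E) x₁ ∘ (extChartAt 𝓘(ℝ, E) x₀).symm) y)).compContinuousLinearMap
        (fderiv ℝ (extChartAt 𝓘(ℝ, E) x₁ ∘ (extChartAt 𝓘(ℝ, E) x₀).symm) y) := by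
  rw [fderiv_coordChange hy hy']
  have hinv := differential_symm_comp (E := E) hy'
  have hpt : (extChartAt 𝓘(ℝ, E) x₁).symm
      (extChartAt 𝓘(ℝ, E) x₁ ((extChartAt 𝓘(ℝ, E) x₀).symm y)) =
      (extChartAt 𝓘(ℝ, E) x₀).symm y := (extChartAt 𝓘(ℝ, E) x₁).left_inv hy'
  ext v
  simp only [inChart, Function.comp_apply, ContinuousAlternatingMap.compContinuousLinearMap_apply,
    hpt]
  congr 1
  funext i
  have := congrArg (fun T : E →L[ℝ] E => T (differential (extChartAt 𝓘(ℝ, E) x₀).symm y (v i))) hinv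
  exact this.symm

theorem inChart_extD {β : DiffForm E M k F} (hβ : IsSmooth β) (x₀ : M) {y : E}
    (hy : y ∈ (extChartAt 𝓘(ℝ, E) x₀).target) :
    inChart (extD β) x₀ y = extDeriv (inChart β x₀) y := by
  set x₁ : M := (extChartAt 𝓘(ℝ, E) x₀).symm y with hx₁
  have hy' : (extChartAt 𝓘(ℝ, E) x₀).symm y ∈ (extChartAt 𝓘(ℝ, E) x₁).source :=
    mem_extChartAt_source x₁
  have hev : inChart β x₀ =ᶠ[𝓝 y] fun z =>
      (inChart β x₁ ((extChartAt 𝓘(ℝ, E) x₁ ∘ (extChartAt 𝓘(ℝ, E) x₀).symm) z)).compContinuousLinearMap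
        (fderiv ℝ (extChartAt 𝓘(ℝ, E) x₁ ∘ (extChartAt 𝓘(ℝ, E) x₀).symm) z) := by
    have h1 := (isOpen_extChartAt_target (I := 𝓘(ℝ, E)) x₀).mem_nhds hy
    have h2 := (contMDiffAt_chart_symm hy).continuousAt.preimage_mem_nhds
      ((isOpen_extChartAt_source (I := 𝓘(ℝ, E)) x₁).mem_nhds hy')
    filter_upwards [h1, h2] with z hz hz'
    exact inChart_coordChange β x₀ x₁ hz hz'
  rw [hev.extDeriv_eq, extDeriv_pullback (r := ∞)
    (f := extChartAt 𝓘(ℝ, E) x₁ ∘ (extChartAt 𝓘(ℝ, E) x₀).symm) (hβ.differentiableAt x₁ ((extChartAt 𝓘(ℝ, E) x₁).map_source hy'))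
    (contDiffAt_coordChange hy hy') two_le, fderiv_coordChange hy hy']
  rfl

theorem IsSmooth.extD {β : DiffForm E M k F} (hβ : IsSmooth β) : IsSmooth (GodbillonVey.extD β) := by
  intro x₀
  have ho := isOpen_extChartAt_target (I := 𝓘(ℝ, E)) x₀
  have h : ContDiffOn ℝ ∞ (extDeriv (inChart β x₀)) (extChartAt 𝓘(ℝ, E) x₀).target := by
    have h1 : ContDiffOn ℝ ∞ (fderiv ℝ (inChart β x₀)) (extChartAt 𝓘(ℝ, E) x₀).target :=
      (hβ x₀).fderiv_of_isOpen ho (by simp)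
    exact (ContinuousLinearMap.contDiff
      (ContinuousAlternatingMap.alternatizeUncurryFinCLM ℝ E F)).comp_contDiffOn h1
  exact h.congr fun y hy => inChart_extD hβ x₀ hy

/-- `d² = 0`. -/
theorem extD_extD {β : DiffForm E M k F} (hβ : IsSmooth β) : GodbillonVey.extD (GodbillonVey.extD β) = 0 := by
  funext x
  have hx := mem_extChartAt_target (I := 𝓘(ℝ, E)) x
  have hev : inChart (GodbillonVey.extD β) x =ᶠ[𝓝 (extChartAt 𝓘(ℝ, E) x x)] extDeriv (inChart β x) := by
    filter_upwards [(isOpen_extChartAt_target (I := 𝓘(ℝ, E)) x).mem_nhds hx] with y hy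
    exact inChart_extD hβ x hy
  rw [GodbillonVey.extD, hev.extDeriv_eq, extDeriv_extDeriv_apply (hβ.contDiffAt x hx) two_le]
  rfl

end Forms

section Algebra

variable {E : Type*} [NormedAddCommGroup E] [NormedSpace ℝ E]

theorem fderiv_wedge_apply {k : ℕ} {a : E → E [⋀^Fin 1]→L[ℝ] ℝ} {b : E → E [⋀^Fin k]→L[ℝ] ℝ} {y : E}
    (ha : DifferentiableAt ℝ a y) (hb : DifferentiableAt ℝ b y) 
    (hab : DifferentiableAt ℝ (wedge a b) y) (u : E) (w : Fin (k + 1) → E) :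
    fderiv ℝ (wedge a b) y u w = ∑ i : Fin (k + 1), (-1 : ℝ) ^ (i : ℕ) *
      (fderiv ℝ a y u (fun _ => w i) * b y (i.removeNth w) +
        a y (fun _ => w i) * fderiv ℝ b y u (i.removeNth w)) := by
  rw [← fderiv_continuousAlternatingMap_apply_const_apply hab]
  have h1 : (fun z => wedge a b z w) = fun z => ∑ i : Fin (k + 1), (-1 : ℝ) ^ (i : ℕ) *
      (a z (fun _ => w i) * b z (i.removeNth w)) := by
    funext z
    simp [wedgeWith_apply]
  have h2 : HasFDerivAt (fun z => ∑ i : Fin (k + 1), (-1 : ℝ) ^ (i : ℕ) *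
      (a z (fun _ => w i) * b z (i.removeNth w))) (∑ i : Fin (k + 1), (-1 : ℝ) ^ (i : ℕ) •
        (a y (fun _ => w i) • fderiv ℝ (fun z => b z (i.removeNth w)) y +
          b y (i.removeNth w) • fderiv ℝ (fun z => a z (fun _ => w i)) y)) y := by
    refine HasFDerivAt.fun_sum fun i _ => ?_
    refine HasFDerivAt.const_mul (HasFDerivAt.mul ?_ ?_) _
    · exact (ha.continuousAlternatingMap_apply_const _).hasFDerivAt
    · exact (hb.continuousAlternatingMap_apply_const _).hasFDerivAt
  rw [h1, h2.fderiv]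
  simp only [sum_apply, smul_apply,
    add_apply, smul_eq_mul,
    fderiv_continuousAlternatingMap_apply_const_apply ha,
    fderiv_continuousAlternatingMap_apply_const_apply hb]
  refine Finset.sum_congr rfl fun i _ => ?_
  ring

theorem removeNth3 (v : Fin 3 → E) : Fin.removeNth 0 v = ![v 1, v 2] ∧
    Fin.removeNth 1 v = ![v 0, v 2] ∧ Fin.removeNth 2 v = ![v 0, v 1] := by
  refine ⟨?_, ?_, ?_⟩ <;> (ext i; fin_cases i <;> rfl)

theorem removeNth2 (v : Fin 2 → E) : Fin.removeNth 0 v = ![v 1] ∧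
    Fin.removeNth 1 v = ![v 0] := by
  refine ⟨?_, ?_⟩ <;> (ext i; fin_cases i; rfl)

theorem removeNth4 (v : Fin 4 → E) : Fin.removeNth 0 v = ![v 1, v 2, v 3] ∧
    Fin.removeNth 1 v = ![v 0, v 2, v 3] ∧ Fin.removeNth 2 v = ![v 0, v 1, v 3] ∧
    Fin.removeNth 3 v = ![v 0, v 1, v 2] := by
  refine ⟨?_, ?_, ?_, ?_⟩ <;> (ext i; fin_cases i <;> rfl)

theorem const_eq (u : E) : (fun _ : Fin 1 => u) = ![u] := by
  ext i; fin_cases i; rfl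

theorem extDeriv1 (a : E → E [⋀^Fin 1]→L[ℝ] ℝ) (y u v : E) :
    extDeriv a y ![u, v] = fderiv ℝ a y u ![v] - fderiv ℝ a y v ![u] := by
  simp [extDeriv, ContinuousAlternatingMap.alternatizeUncurryFin_apply, Fin.sum_univ_succ,
    removeNth2]
  ring

theorem extDeriv2 (b : E → E [⋀^Fin 2]→L[ℝ] ℝ) (y u v w : E) :
    extDeriv b y ![u, v, w] =
      fderiv ℝ b y u ![v, w] - fderiv ℝ b y v ![u, w] + fderiv ℝ b y w ![u, v] := by
  have h := removeNth3 ![u, v, w]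
  rw [extDeriv, ContinuousAlternatingMap.alternatizeUncurryFin_apply]
  refine (Fin.sum_univ_three _).trans ?_
  simp only [h]
  simp
  ring

theorem extDeriv3 (b : E → E [⋀^Fin 3]→L[ℝ] ℝ) (y : E) (v : Fin 4 → E) :
    extDeriv b y v =
      fderiv ℝ b y (v 0) ![v 1, v 2, v 3] - fderiv ℝ b y (v 1) ![v 0, v 2, v 3] +
      fderiv ℝ b y (v 2) ![v 0, v 1, v 3] - fderiv ℝ b y (v 3) ![v 0, v 1, v 2] := by
  have h := removeNth4 v
  rw [extDeriv, ContinuousAlternatingMap.alternatizeUncurryFin_apply]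
  refine (Fin.sum_univ_four _).trans ?_
  simp only [h]
  simp
  ring

theorem wedge_one {a b : E → E [⋀^Fin 1]→L[ℝ] ℝ} (y u v : E) :
    wedge a b y ![u, v] = a y ![u] * b y ![v] - a y ![v] * b y ![u] := by
  simp [wedgeWith_apply, Fin.sum_univ_succ, removeNth2, const_eq]
  ring

theorem fderiv_wedge_one {a b : E → E [⋀^Fin 1]→L[ℝ] ℝ} {y : E}
    (ha : DifferentiableAt ℝ a y) (hb : DifferentiableAt ℝ b y)
    (hab : DifferentiableAt ℝ (wedge a b) y) (u v w : E) :
    fderiv ℝ (wedge a b) y u ![v, w] =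
      fderiv ℝ a y u ![v] * b y ![w] + a y ![v] * fderiv ℝ b y u ![w] -
      fderiv ℝ a y u ![w] * b y ![v] - a y ![w] * fderiv ℝ b y u ![v] := by
  rw [fderiv_wedge_apply ha hb hab]
  simp [Fin.sum_univ_succ, removeNth2, const_eq]
  ring

theorem fderiv_wedge_two {a : E → E [⋀^Fin 1]→L[ℝ] ℝ} {b : E → E [⋀^Fin 2]→L[ℝ] ℝ} {y : E}
    (ha : DifferentiableAt ℝ a y) (hb : DifferentiableAt ℝ b y)
    (hab : DifferentiableAt ℝ (wedge a b) y) (u v w x : E) :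
    fderiv ℝ (wedge a b) y u ![v, w, x] =
      fderiv ℝ a y u ![v] * b y ![w, x] + a y ![v] * fderiv ℝ b y u ![w, x] -
      fderiv ℝ a y u ![w] * b y ![v, x] - a y ![w] * fderiv ℝ b y u ![v, x] +
      fderiv ℝ a y u ![x] * b y ![v, w] + a y ![x] * fderiv ℝ b y u ![v, w] := by
  rw [fderiv_wedge_apply ha hb hab]
  have h := removeNth3 ![v, w, x]
  refine (Fin.sum_univ_three _).trans ?_
  simp only [const_eq, h]
  simp
  ring

theorem contDiffAt_wedge {k : ℕ} {a : E → E [⋀^Fin 1]→L[ℝ] ℝ} {b : E → E [⋀^Fin k]→L[ℝ] ℝ} {y : E}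
    (ha : ContDiffAt ℝ ∞ a y) (hb : ContDiffAt ℝ ∞ b y) : ContDiffAt ℝ ∞ (wedge a b) y :=
  contDiffWithinAt_wedgeWith _ ha hb

theorem chart_closed {t a : E → E [⋀^Fin 1]→L[ℝ] ℝ} {y z : E} (ht : ContDiffAt ℝ ∞ t y)
    (ha : ContDiffAt ℝ ∞ a y) (h : extDeriv t =ᶠ[𝓝 y] wedge t a) (hz : t y ![z] ≠ 0) :
    extDeriv (wedge a (extDeriv a)) y = 0 := by
  have hdb : ContDiffAt ℝ ∞ (extDeriv a) y := by
    have h1 : ContDiffAt ℝ ∞ (fderiv ℝ a) y := ha.fderiv_right (by simp)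
    exact (ContinuousLinearMap.contDiff
      (ContinuousAlternatingMap.alternatizeUncurryFinCLM ℝ E ℝ)).contDiffAt.comp y h1
  have Dt : DifferentiableAt ℝ t y := ht.differentiableAt (by simp)
  have Da : DifferentiableAt ℝ a y := ha.differentiableAt (by simp)
  have Db : DifferentiableAt ℝ (extDeriv a) y := hdb.differentiableAt (by simp)
  have Dta : DifferentiableAt ℝ (wedge t a) y := (contDiffAt_wedge ht ha).differentiableAt (by simp)
  have Dab : DifferentiableAt ℝ (wedge a (extDeriv a)) y :=
    (contDiffAt_wedge ha hdb).differentiableAt (by simp)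
  have h0 : ∀ u v, extDeriv t y ![u, v] = wedge t a y ![u, v] := fun u v => by rw [h.self_of_nhds]
  have h1 : ∀ u v w, extDeriv (wedge t a) y ![u, v, w] = 0 := fun u v w => by
    rw [← h.extDeriv_eq, extDeriv_extDeriv_apply ht two_le]; rfl
  have h2 : ∀ u v w, extDeriv (extDeriv a) y ![u, v, w] = 0 := fun u v w => by
    rw [extDeriv_extDeriv_apply ha two_le]; rfl
  simp only [extDeriv2, extDeriv1, fderiv_wedge_one Dt Da Dta, wedge_one] at h0 h1
  simp only [extDeriv2] at h2
  set b : E → E → ℝ := fun u v => extDeriv a y ![u, v] with hb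
  have hbs : ∀ u v, b u v = fderiv ℝ a y u ![v] - fderiv ℝ a y v ![u] := fun u v =>
    extDeriv1 a y u v
  have key : ∀ u v w, t y ![u] * b v w - t y ![v] * b u w + t y ![w] * b u v = 0 := by
    intro u v w
    simp only [hbs]
    linear_combination a y ![w] * h0 u v - a y ![v] * h0 u w + a y ![u] * h0 v w - h1 u v w
  have hb2 : ∀ u v, b u v = (t y ![u] * b z v - t y ![v] * b z u) / t y ![z] := by
    intro u v
    rw [eq_div_iff hz]
    linear_combination key z u v
  ext v
  rw [extDeriv3]
  simp only [fderiv_wedge_two Da Db Dab]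
  change _ = (0 : ℝ)
  have e : ∀ u v, extDeriv a y ![u, v] = b u v := fun _ _ => rfl
  simp only [e]
  have q : b (v 0) (v 1) * b (v 2) (v 3) - b (v 0) (v 2) * b (v 1) (v 3)
      + b (v 0) (v 3) * b (v 1) (v 2) = 0 := by
    simp only [hb2 (v 0), hb2 (v 1), hb2 (v 2)]
    field_simp
    ring
  simp only [hbs] at q ⊢
  linear_combination 2 * q - a y ![v 0] * h2 (v 1) (v 2) (v 3) + a y ![v 1] * h2 (v 0) (v 2) (v 3)
    - a y ![v 2] * h2 (v 0) (v 1) (v 3) + a y ![v 3] * h2 (v 0) (v 1) (v 2)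
end Algebra

/-! ## De Rham cohomology and the Godbillon-Vey class -/

section DeRham

variable (E M : Type*) [NormedAddCommGroup E] [NormedSpace ℝ E] [TopologicalSpace M]
  [ChartedSpace E M]

/-- The smooth closed real `k`-forms. -/
def closedForms (k : ℕ) : Submodule ℝ (DiffForm E M k ℝ) where
  carrier := {β | IsSmooth β ∧ extD β = 0}
  zero_mem' := ⟨isSmooth_zero, extD_zero⟩
  add_mem' := fun {β γ} hβ hγ => ⟨hβ.1.add hγ.1, by
    rw [extD_add hβ.1 hγ.1, hβ.2, hγ.2, add_zero]⟩
  smul_mem' := fun c β hβ => ⟨hβ.1.smul c, by rw [extD_smul, hβ.2, smul_zero]⟩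

/-- The exact real `k`-forms `dγ`, for `γ` a smooth `(k-1)`-form (only `0` if `k = 0`). -/
def exactForms : (k : ℕ) → Submodule ℝ (DiffForm E M k ℝ)
  | 0 => ⊥
  | k + 1 =>
    { carrier := {β | ∃ γ : DiffForm E M k ℝ, IsSmooth γ ∧ extD γ = β}
      zero_mem' := ⟨0, isSmooth_zero, extD_zero⟩
      add_mem' := by
        rintro _ _ ⟨γ, hγ, rfl⟩ ⟨δ, hδ, rfl⟩
        exact ⟨γ + δ, hγ.add hδ, extD_add hγ hδ⟩
      smul_mem' := by
        rintro c _ ⟨γ, hγ, rfl⟩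
        exact ⟨c • γ, hγ.smul c, extD_smul c γ⟩ }

/-- The de Rham cohomology `H^k(M; ℝ)`: smooth closed forms modulo exact forms. -/
abbrev DeRhamCohomology (k : ℕ) : Type _ :=
  closedForms E M k ⧸ (exactForms E M k).comap (closedForms E M k).subtype

variable {E M}

/-- `α` is a smooth one-form with `dτ = τ ∧ α`, for a smooth nowhere-vanishing one-form `τ`. -/
structure IsGodbillonVeyForm (τ α : DiffForm E M 1 ℝ) : Prop where
  smooth_form : IsSmooth τ
  ne_zero : ∀ x, τ x ≠ 0
  smooth : IsSmooth α
  extD_eq : extD τ = wedge τ α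

variable [IsManifold 𝓘(ℝ, E) ∞ M]

theorem IsGodbillonVeyForm.mem_closedForms {τ α : DiffForm E M 1 ℝ}
    (h : IsGodbillonVeyForm τ α) : wedge α (extD α) ∈ closedForms E M 3 := by
  refine ⟨h.smooth.wedgeWith _ h.smooth.extD, ?_⟩
  funext x
  have hx := mem_extChartAt_target (I := 𝓘(ℝ, E)) x
  have hnhds := (isOpen_extChartAt_target (I := 𝓘(ℝ, E)) x).mem_nhds hx
  have hev : inChart (wedge α (extD α)) x =ᶠ[𝓝 (extChartAt 𝓘(ℝ, E) x x)]
      wedge (inChart α x) (extDeriv (inChart α x)) := by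
    filter_upwards [hnhds] with y hy
    have h1 := congrFun (inChart_wedgeWith (ContinuousLinearMap.mul ℝ ℝ) α (extD α) x) y
    rw [h1]
    simp only [wedge, wedgeWith, inChart_extD h.smooth x hy]
  have hτ : extDeriv (inChart τ x) =ᶠ[𝓝 (extChartAt 𝓘(ℝ, E) x x)]
      wedge (inChart τ x) (inChart α x) := by
    filter_upwards [hnhds] with y hy
    rw [← inChart_extD h.smooth_form x hy, h.extD_eq, inChart_wedgeWith]
  have hne : inChart τ x (extChartAt 𝓘(ℝ, E) x x) ≠ 0 := by
    intro h0
    apply h.ne_zero x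
    have hs : x ∈ (extChartAt 𝓘(ℝ, E) x).source := mem_extChartAt_source x
    have hinv := differential_symm_comp (E := E) hs
    ext v
    have h1 := congrArg (fun f : E [⋀^Fin 1]→L[ℝ] ℝ =>
      f (fun i => differential (E := E) (E' := E) (extChartAt 𝓘(ℝ, E) x) x (v i))) h0
    simp only [inChart, ContinuousAlternatingMap.compContinuousLinearMap_apply,
      (extChartAt 𝓘(ℝ, E) x).left_inv hs] at h1
    refine Eq.trans ?_ h1
    congr 1
    funext i
    exact (congrArg (fun T : E →L[ℝ] E => T (v i)) hinv).symm
  obtain ⟨z, hz⟩ : ∃ z, inChart τ x (extChartAt 𝓘(ℝ, E) x x) ![z] ≠ 0 := by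
    by_contra hcon
    push Not at hcon
    apply hne
    ext v
    have hv : v = ![v 0] := by ext i; fin_cases i; rfl
    rw [hv]
    exact hcon _
  rw [extD, hev.extDeriv_eq, chart_closed (h.smooth_form.contDiffAt x hx)
    (h.smooth.contDiffAt x hx) hτ hz]
  rfl

/-- The Godbillon-Vey class `[α ∧ dα] ∈ H³(M; ℝ)`. -/
def godbillonVeyClass {τ α : DiffForm E M 1 ℝ} (h : IsGodbillonVeyForm τ α) :
    DeRhamCohomology E M 3 :=
  Submodule.Quotient.mk ⟨wedge α (extD α), h.mem_closedForms⟩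

end DeRham

/-! ## Linear groups and `G`-structures -/

section FrameBundle

variable {E M EP P : Type*}
  [NormedAddCommGroup E] [NormedSpace ℝ E] [TopologicalSpace M] [ChartedSpace E M]
  [NormedAddCommGroup EP] [NormedSpace ℝ EP] [TopologicalSpace P] [ChartedSpace EP P]

theorem isUnit_exp [CompleteSpace E] (A : E →L[ℝ] E) : IsUnit (NormedSpace.exp A) :=
  letI := NormedAlgebra.restrictScalars ℚ ℝ (E →L[ℝ] E)
  NormedSpace.isUnit_exp A
  
/-- The exponential of an endomorphism, as an element of `GL(E)`. -/
def expUnit [CompleteSpace E] (A : E →L[ℝ] E) : (E →L[ℝ] E)ˣ := (isUnit_exp A).unit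

/-- The Lie algebra of a closed subgroup `G` of `GL(E)`: the endomorphisms `A` with
`exp (t A) ∈ G` for all `t`. -/
def lieAlgebra [CompleteSpace E] (G : Subgroup (E →L[ℝ] E)ˣ) : Set (E →L[ℝ] E) :=
  {A | ∀ t : ℝ, expUnit (t • A) ∈ G}

theorem contDiff_expUnit [CompleteSpace E] (A : E →L[ℝ] E) :
    ContDiff ℝ ∞ (fun t : ℝ => (expUnit (t • A) : E →L[ℝ] E)) := by
  have h : ContDiff ℝ ∞ (NormedSpace.exp : (E →L[ℝ] E) → (E →L[ℝ] E)) := by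
    rw [contDiff_iff_contDiffAt]
    exact fun x => (NormedSpace.exp_analytic (𝕂 := ℝ) x).contDiffAt
  exact h.comp (contDiff_id.smul contDiff_const)

theorem hasDerivAt_expUnit [CompleteSpace E] (A : E →L[ℝ] E) :
    HasDerivAt (fun t : ℝ => (expUnit (t • A) : E →L[ℝ] E)) A 0 := by
  have h := hasDerivAt_exp_smul_const (𝕂 := ℝ) A (0 : ℝ)
  simp at h
  exact h

/-- The bundle `Hom(E, TM)` over `M`; the frame bundle `F(M)` is the open subset of its invertible
elements. -/
abbrev FrameSpace (E M : Type*) [NormedAddCommGroup E] [NormedSpace ℝ E] [TopologicalSpace M]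
    [ChartedSpace E M] [IsManifold 𝓘(ℝ, E) ∞ M] :=
  Bundle.TotalSpace (E →L[ℝ] E) (fun x : M => Bundle.Trivial M E x →L[ℝ] TangentSpace 𝓘(ℝ, E) x)


variable [IsManifold 𝓘(ℝ, E) ∞ M]
theorem fibreInclusion_smooth (x : M) : ContMDiff 𝓘(ℝ, E →L[ℝ] E) (𝓘(ℝ,E).prod 𝓘(ℝ,E→L[ℝ] E)) ∞
    (fun T : E →L[ℝ] E => (⟨x, T⟩ : FrameSpace E M)) := by
  intro T
  rw [contMDiffAt_hom_bundle]
  refine ⟨contMDiffAt_const, ?_⟩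
  let L : E →L[ℝ] E :=
    (trivializationAt E (TangentSpace 𝓘(ℝ, E) : M → Type _) x).continuousLinearMapAt ℝ x
  let R : E →L[ℝ] E := (trivializationAt E (Bundle.Trivial M E) x).symmL ℝ x
  change ContMDiffAt 𝓘(ℝ, E →L[ℝ] E) 𝓘(ℝ, E →L[ℝ] E) ∞ (fun T : E →L[ℝ] E => L ∘L T ∘L R) T
  rw [contMDiffAt_iff_contDiffAt]
  exact contDiffAt_const.clm_comp (contDiffAt_id.clm_comp contDiffAt_const)

theorem immersion_mfderiv_injective {E₁ E₂ H₁ H₂ N₁ N₂ : Type*} [NormedAddCommGroup E₁]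
    [NormedSpace ℝ E₁] [NormedAddCommGroup E₂] [NormedSpace ℝ E₂] [TopologicalSpace H₁]
    [TopologicalSpace H₂] {I₁ : ModelWithCorners ℝ E₁ H₁} {I₂ : ModelWithCorners ℝ E₂ H₂}
    [I₁.Boundaryless] [I₂.Boundaryless]
    [TopologicalSpace N₁] [ChartedSpace H₁ N₁] [IsManifold I₁ ∞ N₁]
    [TopologicalSpace N₂] [ChartedSpace H₂ N₂] [IsManifold I₂ ∞ N₂] {f : N₁ → N₂} {x : N₁}
    (h : Manifold.IsImmersionAt I₁ I₂ ∞ f x) : Function.Injective (mfderiv I₁ I₂ f x) := by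
  set φ := h.domChart
  set ψ := h.codChart
  have hxφ := h.mem_domChart_source
  have hxψ := h.mem_codChart_source
  let g : N₂ → N₁ := (φ.extend I₁).symm ∘ (fun z => (h.equiv.symm z).1) ∘ (ψ.extend I₂)
  have hgf : g ∘ f =ᶠ[𝓝 x] id := by
    filter_upwards [φ.open_source.mem_nhds hxφ] with y hy
    have h1 : (φ.extend I₁) y ∈ (φ.extend I₁).target :=
      (φ.extend I₁).map_source (by simpa using hy)
    have h2 := h.writtenInCharts h1
    have h3 : (φ.extend I₁).symm ((φ.extend I₁) y) = y :=
      (φ.extend I₁).left_inv (by simpa using hy)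
    simp only [Function.comp_apply] at h2
    rw [h3] at h2
    simp only [g, Function.comp_apply]
    erw [h2]
    simpa using h3
  have hf : MDifferentiableAt I₁ I₂ f x := by
    exact (h.contMDiffAt).mdifferentiableAt (by simp)
  have hg : MDifferentiableAt I₂ I₁ g (f x) := by
    have hfx : ψ.extend I₂ (f x) = h.equiv (φ.extend I₁ x, 0) := by
      have h2 := h.writtenInCharts ((φ.extend I₁).map_source (by simpa using hxφ))
      have h3 : (φ.extend I₁).symm ((φ.extend I₁) x) = x :=
        (φ.extend I₁).left_inv (by simpa using hxφ)
      simp only [Function.comp_apply] at h2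
      rw [h3] at h2
      exact h2
    have s1 : MDifferentiableAt I₂ 𝓘(ℝ, E₂) (ψ.extend I₂) (f x) :=
      (ψ.contMDiffAt_extend h.codChart_mem_maximalAtlas hxψ).mdifferentiableAt (by simp)
    have s2 : MDifferentiableAt 𝓘(ℝ, E₂) 𝓘(ℝ, E₁)
        (fun z : E₂ => (h.equiv.symm z).1) (ψ.extend I₂ (f x)) :=
      (((ContinuousLinearMap.fst ℝ E₁ h.complement) ∘L
        (h.equiv.symm : E₂ →L[ℝ] E₁ × h.complement)).differentiableAt).mdifferentiableAt
    have hpt : (h.equiv.symm (ψ.extend I₂ (f x))).1 = φ.extend I₁ x := by rw [hfx]; simp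
    have s3 : MDifferentiableAt 𝓘(ℝ, E₁) I₁ (φ.extend I₁).symm
        (h.equiv.symm (ψ.extend I₂ (f x))).1 := by
      rw [hpt]
      have hmem : φ.extend I₁ x ∈ (φ.extend I₁).target :=
        (φ.extend I₁).map_source (by simpa using hxφ)
      have ho : IsOpen (φ.extend I₁).target := φ.isOpen_extend_target
      have := contMDiffOn_extend_symm (I := I₁) (n := ∞) h.domChart_mem_maximalAtlas
      rw [← OpenPartialHomeomorph.extend_target'] at this
      exact (this.contMDiffAt (ho.mem_nhds hmem)).mdifferentiableAt (by simp)
    exact s3.comp (f x) (s2.comp (f x) s1)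
  have := mfderiv_comp x hg hf
  rw [hgf.mfderiv_eq] at this
  intro v w hvw
  have hv := congrArg (fun L => L v) this
  have hw := congrArg (fun L => L w) this
  simp [hvw] at hv hw
  exact hv.trans hw.symm


theorem fst_smooth : ContMDiff (𝓘(ℝ,E).prod 𝓘(ℝ,E→L[ℝ] E)) 𝓘(ℝ, E) ∞
    (fun p : FrameSpace E M => p.1) := Bundle.contMDiff_proj _

theorem mk_eq {x y : M} (h : x = y) {T : E →L[ℝ] TangentSpace 𝓘(ℝ, E) x}
    {T' : E →L[ℝ] TangentSpace 𝓘(ℝ, E) y} (hT : ∀ v, (T v : E) = T' v) :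
    (⟨x, T⟩ : FrameSpace E M) = ⟨y, T'⟩ := by
  subst h
  congr 1
  ext v
  exact congrArg (fun w : E => w) (hT v)

/-- A `G`-structure on `M`, for a subgroup `G` of `GL(E)`: a submanifold `P` of the frame bundle of
`M` which is a principal `G`-subbundle. A point `u` of `P` is a frame `u : E ≃ T_x M` at
`x = proj u`. The right action of `G` on `P` is `u · g = u ∘ g`, the fibres of `proj` are the orbits
of `G`, and `proj` has smooth local sections. (As `P` is an embedded submanifold, smoothness of the
action and of the resulting local trivialisations of `P` is automatic.) -/
structure GStructure (M : Type*) [TopologicalSpace M] [ChartedSpace E M] [IsManifold 𝓘(ℝ, E) ∞ M]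
    (P : Type*) [TopologicalSpace P] [ChartedSpace EP P]
    (G : Subgroup (E →L[ℝ] E)ˣ) where
  /-- The projection `π : P → M`. -/
  proj : P → M
  /-- The frame `u : E → T_{π u} M` given by the point `u`. -/
  frame : ∀ u : P, E ≃L[ℝ] TangentSpace 𝓘(ℝ, E) (proj u)
  isSmoothEmbedding : Manifold.IsSmoothEmbedding 𝓘(ℝ, EP) (𝓘(ℝ, E).prod 𝓘(ℝ, E →L[ℝ] E)) ∞
    (fun u : P => (⟨proj u, (frame u : E →L[ℝ] TangentSpace 𝓘(ℝ, E) (proj u))⟩ : FrameSpace E M))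
  /-- The right action of `G`. -/
  act : P → G → P
  proj_act : ∀ u g, proj (act u g) = proj u
  frame_act : ∀ u (g : G) (v : E),
    (frame (act u g) v : E) = frame u (((g : (E →L[ℝ] E)ˣ) : E →L[ℝ] E) v)
  transitive : ∀ u u', proj u = proj u' → ∃ g, act u g = u'
  exists_section : ∀ x : M, ∃ U : Set M, IsOpen U ∧ x ∈ U ∧ ∃ s : M → P,
    ContMDiffOn 𝓘(ℝ, E) 𝓘(ℝ, EP) ∞ s U ∧ ∀ y ∈ U, proj (s y) = y

variable {G : Subgroup (E →L[ℝ] E)ˣ} [IsManifold 𝓘(ℝ, EP) ∞ P]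

namespace GStructure
variable (S : GStructure (EP := EP) M P G)

/-- The inclusion of `P` into the frame bundle. -/
def toFrame (u : P) : FrameSpace E M := ⟨S.proj u, (S.frame u : E →L[ℝ] TangentSpace 𝓘(ℝ, E) (S.proj u))⟩

theorem contMDiff_toFrame : ContMDiff 𝓘(ℝ, EP) (𝓘(ℝ, E).prod 𝓘(ℝ, E →L[ℝ] E)) ∞ S.toFrame :=
  S.isSmoothEmbedding.contMDiff

theorem contMDiff_proj : ContMDiff 𝓘(ℝ, EP) 𝓘(ℝ, E) ∞ S.proj :=
  fst_smooth.comp S.contMDiff_toFrame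

theorem toFrame_act (u : P) (g : G) : S.toFrame (S.act u g) =
    ⟨S.proj u, (S.frame u : E →L[ℝ] TangentSpace 𝓘(ℝ, E) (S.proj u)) ∘L ((g : (E →L[ℝ] E)ˣ) : E →L[ℝ] E)⟩ :=
  mk_eq (S.proj_act u g) (fun v => S.frame_act u g v)

theorem contMDiff_into {E₁ H₁ N₁ : Type*} [NormedAddCommGroup E₁]
    [NormedSpace ℝ E₁] [TopologicalSpace H₁] {I₁ : ModelWithCorners ℝ E₁ H₁}
    [TopologicalSpace N₁] [ChartedSpace H₁ N₁] {f : N₁ → P}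
    (h : ContMDiff I₁ (𝓘(ℝ, E).prod 𝓘(ℝ, E →L[ℝ] E)) ∞ (S.toFrame ∘ f)) :
    ContMDiff I₁ 𝓘(ℝ, EP) ∞ f := by
  have hc : Continuous f := S.isSmoothEmbedding.isEmbedding.continuous_iff.2 h.continuous
  exact (ContMDiff.iff_comp_isImmersion S.isSmoothEmbedding.isImmersion).2 ⟨hc, h⟩

theorem contMDiff_act (g : G) : ContMDiff 𝓘(ℝ, EP) 𝓘(ℝ, EP) ∞ (fun u => S.act u g) := by
  apply S.contMDiff_into
  have hg : S.toFrame ∘ (fun u => S.act u g) = fun u => ⟨S.proj u,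
    (S.frame u : E →L[ℝ] TangentSpace 𝓘(ℝ, E) (S.proj u)) ∘L ((g : (E →L[ℝ] E)ˣ) : E →L[ℝ] E)⟩ := 
    funext fun u => S.toFrame_act u g
  rw [hg]
  intro u
  have h := S.contMDiff_toFrame u
  rw [contMDiffAt_hom_bundle] at h ⊢
  refine ⟨h.1, ?_⟩
  have h2 := h.2
  have h3 : ContMDiffAt 𝓘(ℝ, EP) 𝓘(ℝ, E →L[ℝ] E) ∞ (fun v : P =>
      (ContinuousLinearMap.inCoordinates E (Bundle.Trivial M E) E (TangentSpace 𝓘(ℝ, E))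
        (S.proj u) (S.proj v) (S.proj u) (S.proj v)
        (S.frame v : E →L[ℝ] TangentSpace 𝓘(ℝ, E) (S.proj v))) ∘L
          ((g : (E →L[ℝ] E)ˣ) : E →L[ℝ] E)) u := h2.clm_comp contMDiffAt_const
  refine h3.congr_of_eventuallyEq (Filter.Eventually.of_forall fun v => ?_)
  ext w
  simp [ContinuousLinearMap.inCoordinates]

theorem differential_proj_surjective (u : P) : Function.Surjective (differential (E := EP) (E' := E) S.proj u) := by
  obtain ⟨U, hU, hxU, s, hs, hps⟩ := S.exists_section (S.proj u)
  obtain ⟨g, hg⟩ := S.transitive (s (S.proj u)) u (hps _ hxU)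
  have h1 : MDifferentiableAt 𝓘(ℝ, E) 𝓘(ℝ, EP) s (S.proj u) :=
    (hs.contMDiffAt (hU.mem_nhds hxU)).mdifferentiableAt (by simp)
  have h2 : MDifferentiableAt 𝓘(ℝ, E) 𝓘(ℝ, EP) (fun y => S.act (s y) g) (S.proj u) :=
    ((S.contMDiff_act g).mdifferentiable (by simp) _).comp _ h1
  have h3 : MDifferentiableAt 𝓘(ℝ, EP) 𝓘(ℝ, E) S.proj (S.act (s (S.proj u)) g) :=
    S.contMDiff_proj.mdifferentiable (by simp) _
  have h4 := mfderiv_comp (S.proj u) h3 h2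
  have h5 : S.proj ∘ (fun y => S.act (s y) g) =ᶠ[𝓝 (S.proj u)] id := by
    filter_upwards [hU.mem_nhds hxU] with y hy
    simp [S.proj_act, hps y hy]
  rw [h5.mfderiv_eq] at h4
  intro X
  have h6 := congrArg (fun L : E →L[ℝ] E => L X) h4
  rw [hg] at h6
  exact ⟨_, h6.symm.trans (congrArg (fun L : E →L[ℝ] E => L X) mfderiv_id)⟩

variable [CompleteSpace E]

/-- The fundamental vector `A^#_u = d/dt (u · exp (t A))` at `t = 0`. -/
def fundamental (u : P) (A : lieAlgebra G) : EP :=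
  mfderiv 𝓘(ℝ, ℝ) 𝓘(ℝ, EP) (fun t : ℝ => S.act u ⟨expUnit (t • (A : E →L[ℝ] E)), A.2 t⟩) 0 (1 : ℝ)

theorem mfderiv_toFrame_fundamental (u : P) (A : lieAlgebra G) :
    (mfderiv 𝓘(ℝ, EP) (𝓘(ℝ, E).prod 𝓘(ℝ, E →L[ℝ] E)) S.toFrame u (S.fundamental u A) : E × (E →L[ℝ] E)) =
      mfderiv 𝓘(ℝ, E →L[ℝ] E) (𝓘(ℝ, E).prod 𝓘(ℝ, E →L[ℝ] E))
        (fun T : E →L[ℝ] E => (⟨S.proj u, T⟩ : FrameSpace E M))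
        (S.frame u : E →L[ℝ] TangentSpace 𝓘(ℝ, E) (S.proj u))
        ((S.frame u : E →L[ℝ] TangentSpace 𝓘(ℝ, E) (S.proj u)) ∘L (A : E →L[ℝ] E)) := by
  let Fu : E →L[ℝ] E := (S.frame u : E →L[ℝ] TangentSpace 𝓘(ℝ, E) (S.proj u))
  let c : ℝ → P := fun t => S.act u ⟨expUnit (t • (A : E →L[ℝ] E)), A.2 t⟩
  let e : ℝ → (E →L[ℝ] E) := fun t => Fu ∘L (expUnit (t • (A : E →L[ℝ] E)) : E →L[ℝ] E)
  have he : ContDiff ℝ ∞ e := contDiff_const.clm_comp (contDiff_expUnit _)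
  have hjc : S.toFrame ∘ c = (fun T : E →L[ℝ] E => (⟨S.proj u, T⟩ : FrameSpace E M)) ∘ e :=
    funext fun t => S.toFrame_act u _
  have hjs : ContMDiff 𝓘(ℝ, ℝ) (𝓘(ℝ, E).prod 𝓘(ℝ, E →L[ℝ] E)) ∞ (S.toFrame ∘ c) := by
    rw [hjc]
    exact (fibreInclusion_smooth (S.proj u)).comp he.contMDiff
  have hc : ContMDiff 𝓘(ℝ, ℝ) 𝓘(ℝ, EP) ∞ c := S.contMDiff_into hjs
  have hc0 : c 0 = u := by
    apply S.isSmoothEmbedding.isEmbedding.injective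
    refine (S.toFrame_act u _).trans (mk_eq rfl fun v => ?_)
    simp [expUnit]
  have he0 : e 0 = Fu := by
    ext v
    simp [e, expUnit]
  have h1 := mfderiv_comp (0 : ℝ) (S.contMDiff_toFrame.mdifferentiable (by simp) (c 0))
    (hc.mdifferentiable (by simp) 0)
  have h2 := mfderiv_comp (0 : ℝ) ((fibreInclusion_smooth (S.proj u)).mdifferentiable (by simp) (e 0))
    (he.contMDiff.mdifferentiable (by simp) 0)
  have hde : mfderiv 𝓘(ℝ, ℝ) 𝓘(ℝ, E →L[ℝ] E) e 0 (1 : ℝ) = Fu ∘L (A : E →L[ℝ] E) := by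
    have : HasDerivAt e (Fu ∘L (A : E →L[ℝ] E)) 0 := by
      have := (hasDerivAt_const (0 : ℝ) Fu).clm_comp (hasDerivAt_expUnit (A : E →L[ℝ] E))
      simpa using this
    rw [mfderiv_eq_fderiv]
    exact this.deriv
  rw [hjc, h2] at h1
  have h3 := congrArg (fun L : ℝ →L[ℝ] E × (E →L[ℝ] E) => L 1) h1
  rw [hc0, he0] at h3
  refine h3.symm.trans ?_
  exact congrArg (mfderiv 𝓘(ℝ, E →L[ℝ] E) (𝓘(ℝ, E).prod 𝓘(ℝ, E →L[ℝ] E))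
    (fun T : E →L[ℝ] E => (⟨S.proj u, T⟩ : FrameSpace E M)) Fu) hde

/-- The soldering form `ϑ_u(X) = u⁻¹ (π_* X)`. -/
def soldering : DiffForm EP P 1 E := fun u =>
  ContinuousAlternatingMap.ofSubsingletonLIE (0 : Fin 1)
    (((S.frame u).symm : TangentSpace 𝓘(ℝ, E) (S.proj u) →L[ℝ] E) ∘L
      (mfderiv 𝓘(ℝ, EP) 𝓘(ℝ, E) S.proj u : EP →L[ℝ] TangentSpace 𝓘(ℝ, E) (S.proj u)))

/-- An Ehresmann (principal) connection: a smooth one-form `ω` on `P` with values in the Lie algebra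
of `G`, with `ω(A^#) = A` and `R_g^* ω = g⁻¹ ω g`. -/
structure EhresmannConnection where
  /-- The connection form. -/
  form : DiffForm EP P 1 (E →L[ℝ] E)
  smooth : IsSmooth form
  mem : ∀ u X, toCovector form u X ∈ lieAlgebra G
  fundamental : ∀ u (A : lieAlgebra G), toCovector form u (S.fundamental u A) = A
  equivariant : ∀ u (g : G) X,
    toCovector form (S.act u g) (differential (E := EP) (E' := EP) (fun v => S.act v g) u X) =
      ((g⁻¹ : (E →L[ℝ] E)ˣ) : E →L[ℝ] E) ∘L toCovector form u X ∘L
        ((g : (E →L[ℝ] E)ˣ) : E →L[ℝ] E)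

/-- The `G`-structure is integrable: `M` is covered by charts whose coordinate frames belong to `P`,
i.e. `P` is locally isomorphic to the standard flat `G`-structure on `E`. -/
def IsIntegrable : Prop :=
  ∀ x : M, ∃ e ∈ IsManifold.maximalAtlas 𝓘(ℝ, E) ∞ M, x ∈ e.source ∧
    ∀ y ∈ e.source, ∃ u : P, S.proj u = y ∧
      ∀ v : E, (S.frame u v : E) = differential (E := E) (E' := E) e.symm (e y) v

end GStructure

namespace GStructure.EhresmannConnection

variable {S : GStructure (EP := EP) M P G} [CompleteSpace E] (conn : S.EhresmannConnection)

/-- The torsion `Θ = dϑ + ω ∧ ϑ`, where the Lie algebra acts on `E` by endomorphisms. -/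
def torsion : DiffForm EP P 2 E :=
  extD S.soldering + wedgeWith (ContinuousLinearMap.id ℝ (E →L[ℝ] E)) conn.form S.soldering

/-- The intrinsic torsion of the `G`-structure vanishes: at every `u` the torsion of `ω`, seen as an
element of `Hom(Λ²E, E)` by means of the soldering form, is in the image of the Spencer differential
`∂ : Hom(E, 𝔤) → Hom(Λ²E, E)`, `(∂κ)(v, w) = κ(v) w - κ(w) v`, so that its class in the cokernel
of `∂` is zero. -/
def IntrinsicTorsionVanishes : Prop :=
  ∀ u : P, ∃ κ : E →L[ℝ] (E →L[ℝ] E), (∀ v, κ v ∈ lieAlgebra G) ∧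
    ∀ X Y : EP, conn.torsion u ![X, Y] =
      κ (toCovector S.soldering u X) (toCovector S.soldering u Y) -
        κ (toCovector S.soldering u Y) (toCovector S.soldering u X)

theorem isLinearMap_fundamental (u : P) : IsLinearMap ℝ
    (fun X : EP => S.fundamental u ⟨toCovector conn.form u X, conn.mem u X⟩) := by
  have hinj : Function.Injective
      (mfderiv 𝓘(ℝ, EP) (𝓘(ℝ, E).prod 𝓘(ℝ, E →L[ℝ] E)) S.toFrame u) :=
    immersion_mfderiv_injective (S.isSmoothEmbedding.isImmersion.isImmersionAt u)
  let D : EP →L[ℝ] E × (E →L[ℝ] E) :=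
    mfderiv 𝓘(ℝ, EP) (𝓘(ℝ, E).prod 𝓘(ℝ, E →L[ℝ] E)) S.toFrame u
  let Fu : E →L[ℝ] E := (S.frame u : E →L[ℝ] TangentSpace 𝓘(ℝ, E) (S.proj u))
  let J : (E →L[ℝ] E) →L[ℝ] E × (E →L[ℝ] E) :=
    mfderiv 𝓘(ℝ, E →L[ℝ] E) (𝓘(ℝ, E).prod 𝓘(ℝ, E →L[ℝ] E))
      (fun T : E →L[ℝ] E => (⟨S.proj u, T⟩ : FrameSpace E M)) Fu
  have hD : ∀ X, D (S.fundamental u ⟨toCovector conn.form u X, conn.mem u X⟩) =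
      J (Fu ∘L toCovector conn.form u X) := fun X => S.mfderiv_toFrame_fundamental u _
  constructor
  · intro X Y
    apply hinj
    change D _ = D _
    refine (hD _).trans (Eq.trans ?_ (map_add D _ _).symm)
    rw [hD, hD, map_add, ContinuousLinearMap.comp_add, map_add]
  · intro c X
    apply hinj
    change D _ = D _
    refine (hD _).trans (Eq.trans ?_ (map_smul D _ _).symm)
    rw [hD, map_smul, ContinuousLinearMap.comp_smul, map_smul]

variable [FiniteDimensional ℝ EP]

/-- The projection of `T_u P` onto the horizontal subspace `ker ω_u` along the vertical one:
`X ↦ X - (ω_u X)^#`. -/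
def horizontal (u : P) : EP →L[ℝ] EP :=
  ContinuousLinearMap.id ℝ EP -
    LinearMap.toContinuousLinearMap (conn.isLinearMap_fundamental u).mk'

/-- The horizontal lift of a vector field `Y` on `M`: the horizontal part of an arbitrary preimage
of `Y` under `π_*`. -/
def horizontalLift (Y : M → E) : P → EP := fun u =>
  conn.horizontal u (S.differential_proj_surjective u (Y (S.proj u))).choose

/-- The covariant derivative `d^ω β = (dβ) ∘ hor` on forms on `P`. -/
def covariantDerivative {k : ℕ} {F : Type*} [NormedAddCommGroup F] [NormedSpace ℝ F]
    (β : DiffForm EP P k F) : DiffForm EP P (k + 1) F := fun u =>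
  (extD β u).compContinuousLinearMap (conn.horizontal u)

end GStructure.EhresmannConnection

end FrameBundle

/-! ## Aristotelian structures -/

section Aristotelian

/-- The model space `ℝⁿ`, `n = d + 1`, with basis `(H, s₁, …, s_d)` given by the standard basis;
the dual basis `(η, σ¹, …, σ^d)` consists of the coordinates. -/
abbrev Model (d : ℕ) := EuclideanSpace ℝ (Fin (d + 1))

/-- The group of the linear maps with block matrix `(1, 0; 0, A)`, where `A ∈ O(d)`. -/
def aristotelianGroup (d : ℕ) : Subgroup (Model d →L[ℝ] Model d)ˣ where
  carrier := {g | ∃ A ∈ Matrix.orthogonalGroup (Fin d) ℝ, ∀ v : Model d,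
    (g : Model d →L[ℝ] Model d) v 0 = v 0 ∧
    ∀ a : Fin d, (g : Model d →L[ℝ] Model d) v a.succ = ∑ b : Fin d, A a b * v b.succ}
  one_mem' := ⟨1, one_mem _, fun v => by simp [Matrix.one_apply]⟩
  mul_mem' := by
    rintro g h ⟨A, hA, hg⟩ ⟨B, hB, hh⟩
    refine ⟨A * B, mul_mem hA hB, fun v => ⟨?_, fun a => ?_⟩⟩
    · simp [(hg _).1, (hh _).1]
    · simp only [Units.val_mul, mul_apply_eq_comp, (hg _).2, (hh _).2,
        Matrix.mul_apply, Finset.mul_sum, Finset.sum_mul]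
      rw [Finset.sum_comm]
      simp [mul_assoc]
  inv_mem' := by
    rintro g ⟨A, hA, hg⟩
    have hAA : star A * A = 1 := (Matrix.mem_orthogonalGroup_iff' (Fin d) ℝ).1 hA
    refine ⟨star A, Unitary.star_mem hA, fun v => ?_⟩
    obtain ⟨w, rfl⟩ : ∃ w, v = (g : Model d →L[ℝ] Model d) w :=
      ⟨(g⁻¹ : (Model d →L[ℝ] Model d)ˣ).1 v, by
        rw [← mul_apply_eq_comp]; simp⟩
    have hw : ((g⁻¹ : (Model d →L[ℝ] Model d)ˣ) : Model d →L[ℝ] Model d)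
        ((g : Model d →L[ℝ] Model d) w) = w := by
      rw [← mul_apply_eq_comp]; simp
    rw [hw]
    refine ⟨((hg w).1).symm, fun a => ?_⟩
    simp only [(hg w).2, Finset.mul_sum]
    rw [Finset.sum_comm]
    have h1 : ∀ c, ∑ b, star A a b * (A b c * w c.succ) = (1 : Matrix (Fin d) (Fin d) ℝ) a c *
        w c.succ := fun c => by
      rw [← hAA, Matrix.mul_apply, Finset.sum_mul]
      simp [mul_assoc]
    simp only [h1]
    simp [Matrix.one_apply]

variable (d : ℕ) (M : Type*) [TopologicalSpace M] [ChartedSpace (Model d) M]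
  [IsManifold 𝓘(ℝ, Model d) ∞ M]

/-- An Aristotelian structure `(τ, Z, γ, h)` on a manifold of dimension `d + 1`: the clock form `τ`,
the vector field of observers `Z`, the spatial cometric `γ` and the spatial metric `h`. -/
structure AristotelianStructure where
  /-- The clock form. -/
  τ : DiffForm (Model d) M 1 ℝ
  /-- The vector field of observers. -/
  Z : ∀ x : M, TangentSpace 𝓘(ℝ, Model d) x
  /-- The spatial cometric, a bilinear form on the cotangent spaces. -/
  γ : M → (Model d →L[ℝ] ℝ) →L[ℝ] (Model d →L[ℝ] ℝ) →L[ℝ] ℝ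
  /-- The spatial metric, a bilinear form on the tangent spaces. -/
  h : M → Model d →L[ℝ] Model d →L[ℝ] ℝ
  smooth_τ : IsSmooth τ
  smooth_Z : ContMDiff 𝓘(ℝ, Model d) 𝓘(ℝ, Model d).tangent ∞
    (fun x => (⟨x, Z x⟩ : TangentBundle 𝓘(ℝ, Model d) M))
  /-- The components of `γ` in charts are smooth. -/
  smooth_γ : ∀ (x₀ : M) (ξ ζ : Model d →L[ℝ] ℝ), ContDiffOn ℝ ∞
    (fun y => γ ((extChartAt 𝓘(ℝ, Model d) x₀).symm y)
      (ξ ∘L differential (extChartAt 𝓘(ℝ, Model d) x₀) ((extChartAt 𝓘(ℝ, Model d) x₀).symm y))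
      (ζ ∘L differential (extChartAt 𝓘(ℝ, Model d) x₀) ((extChartAt 𝓘(ℝ, Model d) x₀).symm y)))
    (extChartAt 𝓘(ℝ, Model d) x₀).target
  /-- The components of `h` in charts are smooth. -/
  smooth_h : ∀ (x₀ : M) (v w : Model d), ContDiffOn ℝ ∞
    (fun y => h ((extChartAt 𝓘(ℝ, Model d) x₀).symm y)
      (differential (extChartAt 𝓘(ℝ, Model d) x₀).symm y v)
      (differential (extChartAt 𝓘(ℝ, Model d) x₀).symm y w))
    (extChartAt 𝓘(ℝ, Model d) x₀).target
  τ_Z : ∀ x, toCovector τ x (Z x) = 1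
  γ_symm : ∀ x ξ ζ, γ x ξ ζ = γ x ζ ξ
  γ_nonneg : ∀ x ξ, 0 ≤ γ x ξ ξ
  γ_τ : ∀ x ξ, γ x (toCovector τ x) ξ = 0
  γ_corank : ∀ x ξ, γ x ξ ξ = 0 → ∃ c : ℝ, ξ = c • toCovector τ x
  h_symm : ∀ x X Y, h x X Y = h x Y X
  h_nonneg : ∀ x X, 0 ≤ h x X X
  h_Z : ∀ x X, h x (Z x) X = 0
  h_corank : ∀ x X, h x X X = 0 → ∃ c : ℝ, X = c • (Z x : Model d)

variable {d M}

namespace AristotelianStructure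

variable {EP P : Type*} [NormedAddCommGroup EP] [NormedSpace ℝ EP]
  [FiniteDimensional ℝ EP] [TopologicalSpace P] [ChartedSpace EP P] [IsManifold 𝓘(ℝ, EP) ∞ P]
  (A : AristotelianStructure d M)

/-- The structure is (Frobenius) integrable: `τ ∧ dτ = 0`. -/
def IsIntegrable : Prop := wedge A.τ (extD A.τ) = 0

/-- The tensors `(τ, Z, γ, h)` are those induced by a `G`-structure for the Aristotelian group: every
frame `u ∈ P` at `x` takes `H`, `η`, `∑ s_a ⊗ s_a` and `∑ σ^a ⊗ σ^a` to `Z_x`, `τ_x`, `γ_x`, `h_x`. -/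
structure IsInducedBy (S : GStructure (EP := EP) M P (aristotelianGroup d)) : Prop where
  Z_eq : ∀ u, (S.frame u (EuclideanSpace.single 0 1) : Model d) = A.Z (S.proj u)
  τ_eq : ∀ u v, toCovector A.τ (S.proj u) (S.frame u v) = v 0
  γ_eq : ∀ u (ξ ζ : Model d →L[ℝ] ℝ), A.γ (S.proj u) ξ ζ = ∑ a : Fin d,
    ξ (S.frame u (EuclideanSpace.single a.succ 1)) * ζ (S.frame u (EuclideanSpace.single a.succ 1))
  h_eq : ∀ u (v w : Model d), A.h (S.proj u) (S.frame u v) (S.frame u w) =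
    ∑ a : Fin d, v a.succ * w a.succ

/-- The two-form `Θ̄_u = ⟨u(Θ_u), τ_{π u}⟩` on `P`. -/
def clockTorsion {S : GStructure (EP := EP) M P (aristotelianGroup d)}
    (conn : S.EhresmannConnection) : DiffForm EP P 2 ℝ := fun u =>
  ((toCovector A.τ (S.proj u) : TangentSpace 𝓘(ℝ, Model d) (S.proj u) →L[ℝ] ℝ) ∘L
    (S.frame u : Model d →L[ℝ] TangentSpace 𝓘(ℝ, Model d) (S.proj u))).compContinuousAlternatingMap
    (conn.torsion u)

/-- The one-form `ι_{Z̄} Θ̄` on `P`, where `Z̄` is the horizontal lift of `Z`. -/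
def observedTorsion {S : GStructure (EP := EP) M P (aristotelianGroup d)}
    (conn : S.EhresmannConnection) : DiffForm EP P 1 ℝ :=
  interior (conn.horizontalLift A.Z) (A.clockTorsion conn)

end AristotelianStructure

end Aristotelian

end GodbillonVey

end

open GodbillonVey

namespace GodbillonVey

/-! ### Exterior calculus in vector spaces and in charts -/

section Calculus

variable {E E' M N F F' : Type*}
  [NormedAddCommGroup E] [NormedSpace ℝ E] [TopologicalSpace M] [ChartedSpace E M]
  [NormedAddCommGroup E'] [NormedSpace ℝ E'] [TopologicalSpace N] [ChartedSpace E' N]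
  [NormedAddCommGroup F] [NormedSpace ℝ F] [NormedAddCommGroup F'] [NormedSpace ℝ F'] {k : ℕ}

/-! Everything follows from the identity `Θ̄ = π^* dτ` (`clockTorsion_eq_pullback`). Each frame `u ∈
P` turns `τ` into the first coordinate `η` of the model space, so `η ∘ ϑ = π^* τ`. The group fixes
`η`, so its Lie algebra has image in `ker η`, and the term `ω ∧ ϑ` contributes nothing to the first
component of `Θ = dϑ + ω ∧ ϑ`. That component is therefore `d(π^* τ) = π^* dτ`, whatever the
connection.

The canonical form is `α = ι_Z dτ`. Contracting `τ ∧ dτ = 0` with `Z`, where `τ(Z) = 1`, gives `dτ =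
τ ∧ ι_Z dτ`; contracting `dτ = τ ∧ α` with `Z`, where `α(Z) = 0`, gives `α = ι_Z dτ`. This is
existence and uniqueness. Since `Z̄` projects to `Z`, the one-form `ι_{Z̄} Θ̄` equals `π^* α`. The
horizontal projection does not change `π_*`, so `d^ω` is `d` on forms pulled back from `M`, and the
formula for `π^*(α ∧ dα)` is naturality of `d` and `∧`.

For the vanishing statements, each hypothesis forces `dτ = 0`. If `Θ` is zero, or lies pointwise in
the image of the Spencer differential, its first component vanishes, so `π^* dτ = 0`, and `π` is a
surjective submersion. If `P` is integrable, `τ` is the constant form `η` in each adapted chart.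
Once `dτ = 0`, any admissible `α` satisfies `τ ∧ α = 0`, hence `α = α(Z) τ`; differentiating `τ ∧ α
= 0` gives `τ ∧ dα = 0`. Thus `α ∧ dα = α(Z) τ ∧ dα = 0` already as a form (`wedge_extD_eq_zero`).
The last assertion is the contrapositive.

The analytic work lies in naturality of the exterior derivative (`extD_eq_pullback_extD`) and
smoothness of the soldering form (`isSmooth_soldering`), without which `d` could not be applied as
above. -/

theorem toCovector_apply (a : DiffForm E M 1 F) (x : M) (v : E) :
    toCovector a x v = a x fun _ => v := by
  simp [toCovector]

theorem ext_one_form {a b : E [⋀^Fin 1]→L[ℝ] F} (h : ∀ v : E, a (fun _ => v) = b fun _ => v) :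
    a = b := by
  ext v
  have hv : v = fun _ => v 0 := by ext i; fin_cases i; rfl
  rw [hv]
  exact h _

theorem eq_vec_two (v : Fin 2 → E) : v = ![v 0, v 1] := by
  ext i; fin_cases i <;> rfl

theorem wedge_one_apply (a b : DiffForm E M 1 ℝ) (x : M) (u v : E) :
    wedge a b x ![u, v] = toCovector a x u * toCovector b x v -
      toCovector a x v * toCovector b x u := by
  rw [wedgeWith_apply]
  refine (Fin.sum_univ_two _).trans ?_
  simp only [removeNth2, const_eq, toCovector_apply]
  simp
  ring

theorem wedge_two_apply (a : DiffForm E M 1 ℝ) (b : DiffForm E M 2 ℝ) (x : M) (u v w : E) :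
    wedge a b x ![u, v, w] = toCovector a x u * b x ![v, w] - toCovector a x v * b x ![u, w] +
      toCovector a x w * b x ![u, v] := by
  have h := removeNth3 ![u, v, w]
  rw [wedgeWith_apply]
  refine (Fin.sum_univ_three _).trans ?_
  simp only [h, const_eq, toCovector_apply]
  simp
  ring

theorem toCovector_interior (X : M → E) (b : DiffForm E M 2 F) (x : M) (v : E) :
    toCovector (interior X b) x v = b x ![X x, v] := by
  simp only [toCovector_apply, interior, ContinuousAlternatingMap.curryLeft_apply_apply]
  congr 1
  ext i; fin_cases i <;> rfl

theorem pullback_wedge (f : N → M) (a : DiffForm E M 1 ℝ) (b : DiffForm E M k ℝ) :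
    pullback (E' := E') f (wedge a b) = wedge (pullback f a) (pullback f b) := by
  ext u v
  simp only [pullback, wedgeWith_apply, ContinuousAlternatingMap.compContinuousLinearMap_apply]
  rfl

/-- This is the Leibniz rule `d(a ∧ b) = da ∧ b - a ∧ db`. As `wedge` takes its one-form on the
left, `da ∧ b` appears as `b ∧ da`; a two-form and a one-form commute, so no sign arises. -/
theorem extDeriv_wedge_one {a b : E → E [⋀^Fin 1]→L[ℝ] ℝ} {y : E} (ha : ContDiffAt ℝ ∞ a y)
    (hb : ContDiffAt ℝ ∞ b y) :
    extDeriv (wedge a b) y = wedge b (extDeriv a) y - wedge a (extDeriv b) y := by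
  ext v
  have hv : v = ![v 0, v 1, v 2] := by ext i; fin_cases i <;> rfl
  rw [hv]
  simp only [ContinuousAlternatingMap.sub_apply, wedge_two_apply, extDeriv2, extDeriv1,
    toCovector_apply, const_eq,
    fderiv_wedge_one (ha.differentiableAt (by simp)) (hb.differentiableAt (by simp))
      ((contDiffAt_wedge ha hb).differentiableAt (by simp))]
  ring

/-! ### Transfer to manifolds and naturality -/

variable [IsManifold 𝓘(ℝ, E) ∞ M] [IsManifold 𝓘(ℝ, E') ∞ N]

theorem differential_comp_symm {x₁ : M} {y : E} (hy : y ∈ (extChartAt 𝓘(ℝ, E) x₁).target) :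
    differential (E := E) (E' := E) (extChartAt 𝓘(ℝ, E) x₁) ((extChartAt 𝓘(ℝ, E) x₁).symm y) ∘L
      differential (E := E) (E' := E) (extChartAt 𝓘(ℝ, E) x₁).symm y =
      ContinuousLinearMap.id ℝ E := by
  -- The composite is the derivative of the transition map from the chart to itself, which is the
  -- identity near `y`.
  have h1 := fderiv_coordChange (x₁ := x₁) hy ((extChartAt 𝓘(ℝ, E) x₁).map_target hy)
  rw [← h1]
  have h2 : extChartAt 𝓘(ℝ, E) x₁ ∘ (extChartAt 𝓘(ℝ, E) x₁).symm =ᶠ[𝓝 y] id := by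
    filter_upwards [(isOpen_extChartAt_target (I := 𝓘(ℝ, E)) x₁).mem_nhds hy] with z hz
    exact (extChartAt 𝓘(ℝ, E) x₁).right_inv hz
  rw [h2.fderiv_eq]
  exact fderiv_id

/-- The tangent map of the chart undoes the pullback along its inverse, so a coordinate expression
determines the form. Identities checked in a vector space thus return to the manifold. -/
theorem inChart_injective {β γ : DiffForm E M k F} {x₀ : M} {y : E}
    (hy : y ∈ (extChartAt 𝓘(ℝ, E) x₀).target) (h : inChart β x₀ y = inChart γ x₀ y) :
    β ((extChartAt 𝓘(ℝ, E) x₀).symm y) = γ ((extChartAt 𝓘(ℝ, E) x₀).symm y) := by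
  have hs := (extChartAt 𝓘(ℝ, E) x₀).map_target hy
  have hinv := differential_symm_comp (E := E) hs
  rw [(extChartAt 𝓘(ℝ, E) x₀).right_inv hy] at hinv
  have h' : ∀ δ : DiffForm E M k F, δ ((extChartAt 𝓘(ℝ, E) x₀).symm y) =
      (inChart δ x₀ y).compContinuousLinearMap (differential (E := E) (E' := E)
        (extChartAt 𝓘(ℝ, E) x₀) ((extChartAt 𝓘(ℝ, E) x₀).symm y)) := by
    intro δ
    ext v
    simp only [inChart, ContinuousAlternatingMap.compContinuousLinearMap_apply]
    congr 1
    funext i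
    exact (congrArg (fun T : E →L[ℝ] E => T (v i)) hinv).symm
  rw [h' β, h' γ, h]

/-- The exterior derivative of a wedge product of one-forms. -/
theorem extD_wedge_one {a b : DiffForm E M 1 ℝ} (ha : IsSmooth a) (hb : IsSmooth b) :
    extD (wedge a b) = wedge b (extD a) - wedge a (extD b) := by
  funext x
  have hx := mem_extChartAt_target (I := 𝓘(ℝ, E)) x
  have hd : ∀ c : DiffForm E M 1 ℝ, IsSmooth c → ∀ b' : DiffForm E M 1 ℝ,
      inChart (wedge b' (extD c)) x (extChartAt 𝓘(ℝ, E) x x) =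
        wedge (inChart b' x) (extDeriv (inChart c x)) (extChartAt 𝓘(ℝ, E) x x) := by
    intro c hc b'
    rw [inChart_wedgeWith]
    simp only [wedge, wedgeWith, inChart_extD hc x hx]
  have key : inChart (extD (wedge a b)) x (extChartAt 𝓘(ℝ, E) x x) =
      inChart (wedge b (extD a) - wedge a (extD b)) x (extChartAt 𝓘(ℝ, E) x x) := by
    rw [inChart_extD (ha.wedgeWith _ hb) x hx, inChart_wedgeWith,
      extDeriv_wedge_one (ha.contDiffAt x hx) (hb.contDiffAt x hx), ← hd a ha, ← hd b hb]
    ext v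
    simp [inChart]
  have := inChart_injective hx key
  rwa [(extChartAt 𝓘(ℝ, E) x).left_inv (mem_extChartAt_source x)] at this

/-- A smooth map read in preferred charts. -/
theorem contDiffAt_writtenInCharts {f : N → M} {x : N}
    (hf : ContMDiffAt 𝓘(ℝ, E') 𝓘(ℝ, E) ∞ f x) {x₀ : N} {y : E'}
    (hy : y ∈ (extChartAt 𝓘(ℝ, E') x₀).target) (hx : (extChartAt 𝓘(ℝ, E') x₀).symm y = x)
    {z₀ : M} (hz : f x ∈ (extChartAt 𝓘(ℝ, E) z₀).source) :
    ContDiffAt ℝ ∞ (extChartAt 𝓘(ℝ, E) z₀ ∘ f ∘ (extChartAt 𝓘(ℝ, E') x₀).symm) y := by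
  subst hx
  rw [← contMDiffAt_iff_contDiffAt]
  exact (contMDiffAt_extChartAt' (n := ∞) (by simpa using hz)).comp y
    (hf.comp y (contMDiffAt_chart_symm hy))

theorem fderiv_writtenInCharts {f : N → M} {x₀ : N} {y : E'}
    (hf : MDifferentiableAt 𝓘(ℝ, E') 𝓘(ℝ, E) f ((extChartAt 𝓘(ℝ, E') x₀).symm y))
    (hy : y ∈ (extChartAt 𝓘(ℝ, E') x₀).target) {z₀ : M}
    (hz : f ((extChartAt 𝓘(ℝ, E') x₀).symm y) ∈ (extChartAt 𝓘(ℝ, E) z₀).source) :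
    fderiv ℝ (extChartAt 𝓘(ℝ, E) z₀ ∘ f ∘ (extChartAt 𝓘(ℝ, E') x₀).symm) y =
      differential (E := E) (E' := E) (extChartAt 𝓘(ℝ, E) z₀)
        (f ((extChartAt 𝓘(ℝ, E') x₀).symm y)) ∘L
      differential (E := E') (E' := E) f ((extChartAt 𝓘(ℝ, E') x₀).symm y) ∘L
        differential (E := E') (E' := E') (extChartAt 𝓘(ℝ, E') x₀).symm y := by
  rw [← mfderiv_eq_fderiv]
  have h1 := mfderiv_comp y hf (mdifferentiableAt_chart_symm hy)
  have h2 := mfderiv_comp y (mdifferentiableAt_chart (E := E) hz)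
    (hf.comp y (mdifferentiableAt_chart_symm hy))
  exact h2.trans (congrArg (fun L : E' →L[ℝ] E => (differential (E := E) (E' := E)
    (extChartAt 𝓘(ℝ, E) z₀) (f ((extChartAt 𝓘(ℝ, E') x₀).symm y))) ∘L L) h1)

/-- A pullback read in preferred charts. -/
theorem inChart_pullback (β : DiffForm E M k F) {f : N → M} {x₀ : N} {y : E'}
    (hf : MDifferentiableAt 𝓘(ℝ, E') 𝓘(ℝ, E) f ((extChartAt 𝓘(ℝ, E') x₀).symm y))
    (hy : y ∈ (extChartAt 𝓘(ℝ, E') x₀).target) {z₀ : M}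
    (hz : f ((extChartAt 𝓘(ℝ, E') x₀).symm y) ∈ (extChartAt 𝓘(ℝ, E) z₀).source) :
    inChart (pullback f β) x₀ y = (inChart β z₀ ((extChartAt 𝓘(ℝ, E) z₀ ∘ f ∘
      (extChartAt 𝓘(ℝ, E') x₀).symm) y)).compContinuousLinearMap
        (fderiv ℝ (extChartAt 𝓘(ℝ, E) z₀ ∘ f ∘ (extChartAt 𝓘(ℝ, E') x₀).symm) y) := by
  rw [fderiv_writtenInCharts hf hy hz]
  have hinv := differential_symm_comp (E := E) hz
  have hpt := (extChartAt 𝓘(ℝ, E) z₀).left_inv hz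
  ext v
  simp only [inChart, pullback, Function.comp_apply,
    ContinuousAlternatingMap.compContinuousLinearMap_apply, hpt]
  congr 1
  funext i
  exact (congrArg (fun T : E →L[ℝ] E => T (differential (E := E') (E' := E) f
    ((extChartAt 𝓘(ℝ, E') x₀).symm y)
      (differential (E := E') (E' := E') (extChartAt 𝓘(ℝ, E') x₀).symm y (v i)))) hinv).symm

/-- The exterior derivative is natural; only the germs of the form and the map matter. -/
theorem extD_eq_pullback_extD {β : DiffForm E M k F} (hβ : IsSmooth β) {f : N → M} {x : N}
    (hf : ContMDiffAt 𝓘(ℝ, E') 𝓘(ℝ, E) ∞ f x) {δ : DiffForm E' N k F}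
    (hδ : δ =ᶠ[𝓝 x] pullback f β) : extD δ x = pullback f (extD β) x := by
  set y := extChartAt 𝓘(ℝ, E') x x with hy
  have hyt : y ∈ (extChartAt 𝓘(ℝ, E') x).target := mem_extChartAt_target x
  have hyx : (extChartAt 𝓘(ℝ, E') x).symm y = x :=
    (extChartAt 𝓘(ℝ, E') x).left_inv (mem_extChartAt_source x)
  set Φ : E' → E := extChartAt 𝓘(ℝ, E) (f x) ∘ f ∘ (extChartAt 𝓘(ℝ, E') x).symm with hΦ
  have hc : ContinuousAt (extChartAt 𝓘(ℝ, E') x).symm y :=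
    (contMDiffAt_chart_symm hyt).continuousAt
  have hev : inChart δ x =ᶠ[𝓝 y] fun z =>
      (inChart β (f x) (Φ z)).compContinuousLinearMap (fderiv ℝ Φ z) := by
    have h1 := (isOpen_extChartAt_target (I := 𝓘(ℝ, E')) x).mem_nhds hyt
    have h2 : ∀ᶠ x' in 𝓝 x, f x' ∈ (extChartAt 𝓘(ℝ, E) (f x)).source :=
      hf.continuousAt.preimage_mem_nhds (extChartAt_source_mem_nhds (f x))
    -- Differentiating the coordinate expression needs the pullback formula on a whole
    -- neighbourhood. The order is lowered to 1 because smoothness at a point spreads to a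
    -- neighbourhood only for orders other than `∞`.
    have h3 : ∀ᶠ x' in 𝓝 x, MDifferentiableAt 𝓘(ℝ, E') 𝓘(ℝ, E) f x' := by
      have h4 : ContMDiffAt 𝓘(ℝ, E') 𝓘(ℝ, E) 1 f x := hf.of_le (by simp)
      filter_upwards [(contMDiffAt_iff_contMDiffAt_nhds (by simp)).1 h4] with x' hx'
      exact hx'.mdifferentiableAt (by simp)
    have hc' : Filter.Tendsto (extChartAt 𝓘(ℝ, E') x).symm (𝓝 y) (𝓝 x) := by
      have := hc.tendsto
      rwa [hyx] at this
    filter_upwards [h1, hc'.eventually h2, hc'.eventually h3, hc'.eventually hδ]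
      with z hz1 hz2 hz3 hz4
    rw [← inChart_pullback β hz3 hz1 hz2]
    simp only [inChart, hz4]
  have hfx : f x ∈ (extChartAt 𝓘(ℝ, E) (f x)).source := mem_extChartAt_source _
  have hΦy : Φ y = extChartAt 𝓘(ℝ, E) (f x) (f x) := by
    change extChartAt 𝓘(ℝ, E) (f x) (f ((extChartAt 𝓘(ℝ, E') x).symm y)) = _
    rw [hyx]
  have hΦt : Φ y ∈ (extChartAt 𝓘(ℝ, E) (f x)).target := by
    rw [hΦy]; exact mem_extChartAt_target _
  have hfd : MDifferentiableAt 𝓘(ℝ, E') 𝓘(ℝ, E) f ((extChartAt 𝓘(ℝ, E') x).symm y) := by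
    rw [hyx]; exact hf.mdifferentiableAt (by simp)
  have hz : f ((extChartAt 𝓘(ℝ, E') x).symm y) ∈ (extChartAt 𝓘(ℝ, E) (f x)).source := by
    rw [hyx]; exact hfx
  have key : inChart (extD δ) x y = inChart (pullback f (extD β)) x y := by
    rw [inChart_pullback _ hfd hyt hz, inChart_extD hβ _ hΦt]
    rw [← hΦ, ← extDeriv_pullback (r := ∞) (hβ.differentiableAt _ hΦt) (contDiffAt_writtenInCharts hf hyt hyx hfx) two_le,
      ← hev.extDeriv_eq]
    -- `extD δ x` is defined in the chart at `x`; reading it back in that chart inserts the tangent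
    -- map of the chart composed with that of its inverse, which is the identity.
    have hinv := differential_comp_symm hyt
    rw [hyx] at hinv
    ext v
    simp only [inChart, extD, hyx, ContinuousAlternatingMap.compContinuousLinearMap_apply, ← hy]
    congr 1
    funext i
    exact congrArg (fun T : E' →L[ℝ] E' => T (v i)) hinv
  have := inChart_injective hyt key
  rwa [hyx] at this

theorem extD_pullback {β : DiffForm E M k F} (hβ : IsSmooth β) {f : N → M}
    (hf : ContMDiff 𝓘(ℝ, E') 𝓘(ℝ, E) ∞ f) : extD (pullback (E' := E') f β) = pullback f (extD β) :=
  funext fun x => extD_eq_pullback_extD hβ (hf x) Filter.EventuallyEq.rfl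

/-- The exterior derivative commutes with continuous linear maps of the values. -/
theorem extD_compContinuousAlternatingMap (L : F →L[ℝ] F') {β : DiffForm E M k F}
    (hβ : IsSmooth β) :
    extD (fun x => L.compContinuousAlternatingMap (β x)) =
      fun x => L.compContinuousAlternatingMap (extD β x) := by
  funext x
  have hx := mem_extChartAt_target (I := 𝓘(ℝ, E)) x
  have h1 : inChart (fun x => L.compContinuousAlternatingMap (β x)) x =
      fun y => ContinuousLinearMap.compContinuousAlternatingMapCLM ℝ E F F' (Fin k) L
        (inChart β x y) := by
    ext y v; simp [inChart]
  have h2 := (ContinuousLinearMap.compContinuousAlternatingMapCLM ℝ E F F'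
    (Fin k) L).hasFDerivAt.comp _ (hβ.differentiableAt x hx).hasFDerivAt
  ext v
  simp only [extD, h1, extDeriv]
  erw [h2.fderiv]
  simp [ContinuousAlternatingMap.alternatizeUncurryFin_apply]

/-- The interior product with a smooth vector field preserves smoothness. -/
theorem IsSmooth.interior {β : DiffForm E M (k + 1) F} (hβ : IsSmooth β)
    {X : ∀ x : M, TangentSpace 𝓘(ℝ, E) x} (hX : ContMDiff 𝓘(ℝ, E) 𝓘(ℝ, E).tangent ∞
      (fun x => (⟨x, X x⟩ : TangentBundle 𝓘(ℝ, E) M))) :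
    IsSmooth (GodbillonVey.interior X β) := by
  intro x₀
  have ho := isOpen_extChartAt_target (I := 𝓘(ℝ, E)) x₀
  have hXc : ContDiffOn ℝ ∞ (fun y => differential (E := E) (E' := E) (extChartAt 𝓘(ℝ, E) x₀)
      ((extChartAt 𝓘(ℝ, E) x₀).symm y) (X ((extChartAt 𝓘(ℝ, E) x₀).symm y)))
      (extChartAt 𝓘(ℝ, E) x₀).target := by
    intro y hy
    have hs := (extChartAt 𝓘(ℝ, E) x₀).map_target hy
    have h1 := (Bundle.Trivialization.contMDiffAt_section_iff (n := ∞) (IB := 𝓘(ℝ, E))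
      (trivializationAt E (TangentSpace 𝓘(ℝ, E)) x₀) (s := X)
      (x₀ := (extChartAt 𝓘(ℝ, E) x₀).symm y) (by simpa using hs)).1 (hX _)
    have h2 := h1.comp y (contMDiffAt_chart_symm hy)
    rw [contMDiffAt_iff_contDiffAt] at h2
    refine (h2.congr_of_eventuallyEq ?_).contDiffWithinAt
    filter_upwards [ho.mem_nhds hy] with z hz
    have hz' := (extChartAt 𝓘(ℝ, E) x₀).map_target hz
    -- On fibres the bundle trivialization at `x₀` is the tangent map of the chart, so a smooth
    -- section has smooth chart components.
    have h3 := TangentBundle.continuousLinearMapAt_trivializationAt (I := 𝓘(ℝ, E))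
      (x₀ := x₀) (x := (extChartAt 𝓘(ℝ, E) x₀).symm z) (by simpa using hz')
    have h4 := congrArg (fun T : E →L[ℝ] E => T (X ((extChartAt 𝓘(ℝ, E) x₀).symm z))) h3
    refine h4.symm.trans ?_
    exact congrFun (Bundle.Trivialization.coe_linearMapAt_of_mem (R := ℝ)
      (trivializationAt E (TangentSpace 𝓘(ℝ, E)) x₀)
      (b := (extChartAt 𝓘(ℝ, E) x₀).symm z) (by simpa using hz')) _
  have hC : ContDiff ℝ ∞ fun L : E [⋀^Fin (k + 1)]→L[ℝ] F => L.curryLeft := by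
    let L : (E [⋀^Fin (k + 1)]→L[ℝ] F) →L[ℝ] (E →L[ℝ] E [⋀^Fin k]→L[ℝ] F) :=
      (ContinuousAlternatingMap.curryLeftLI : (E [⋀^Fin (k + 1)]→L[ℝ] F) →ₗᵢ[ℝ]
        (E →L[ℝ] E [⋀^Fin k]→L[ℝ] F)).toContinuousLinearMap
    have hL : ContDiff ℝ ∞ L := by fun_prop
    exact hL
  refine ((hC.comp_contDiffOn (hβ x₀)).clm_apply hXc).congr fun y hy => ?_
  have hs := (extChartAt 𝓘(ℝ, E) x₀).map_target hy
  have hinv := differential_symm_comp (E := E) hs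
  rw [(extChartAt 𝓘(ℝ, E) x₀).right_inv hy] at hinv
  ext v
  set p := (extChartAt 𝓘(ℝ, E) x₀).symm y
  set D : E →L[ℝ] E := differential (E := E) (E' := E) (extChartAt 𝓘(ℝ, E) x₀).symm y
  set D' : E →L[ℝ] E := differential (E := E) (E' := E) (extChartAt 𝓘(ℝ, E) x₀) p
  -- The two sides differ only in slot 0, where `D (D' (X p)) = X p`.
  change β p (Matrix.vecCons (X p) fun i => D (v i)) =
    β p (fun i => D (Matrix.vecCons (D' (X p)) v i))
  congr 1
  funext i
  refine Fin.cases ?_ (fun j => rfl) i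
  exact (congrArg (fun T : E →L[ℝ] E => T (X p)) hinv).symm

end Calculus

/-! ### Soldering form, vertical vectors and horizontal lifts -/

section Frames

variable {E M EP P : Type*}
  [NormedAddCommGroup E] [NormedSpace ℝ E] [TopologicalSpace M] [ChartedSpace E M]
  [NormedAddCommGroup EP] [NormedSpace ℝ EP] [TopologicalSpace P] [ChartedSpace EP P]
  [IsManifold 𝓘(ℝ, E) ∞ M]

/-- The tangent map of a preferred chart as an isomorphism. -/
noncomputable def chartDifferential (x₁ x : M) (hx : x ∈ (extChartAt 𝓘(ℝ, E) x₁).source) :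
    E ≃L[ℝ] E :=
  ContinuousLinearEquiv.equivOfInverse (differential (E := E) (E' := E) (extChartAt 𝓘(ℝ, E) x₁) x)
    (differential (E := E) (E' := E) (extChartAt 𝓘(ℝ, E) x₁).symm (extChartAt 𝓘(ℝ, E) x₁ x))
    (fun v => congrArg (fun T : E →L[ℝ] E => T v) (differential_symm_comp hx))
    (fun v => by
      have h := differential_comp_symm ((extChartAt 𝓘(ℝ, E) x₁).map_source hx)
      rw [(extChartAt 𝓘(ℝ, E) x₁).left_inv hx] at h
      exact congrArg (fun T : E →L[ℝ] E => T v) h)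

variable {G : Subgroup (E →L[ℝ] E)ˣ} [IsManifold 𝓘(ℝ, EP) ∞ P] (S : GStructure (EP := EP) M P G)

namespace GStructure

theorem toCovector_soldering (u : P) (X : EP) : S.frame u (toCovector S.soldering u X) =
    mfderiv 𝓘(ℝ, EP) 𝓘(ℝ, E) S.proj u X := by
  have h : toCovector S.soldering u = ((S.frame u).symm : TangentSpace 𝓘(ℝ, E) (S.proj u) →L[ℝ] E) ∘L
      (mfderiv 𝓘(ℝ, EP) 𝓘(ℝ, E) S.proj u : EP →L[ℝ] TangentSpace 𝓘(ℝ, E) (S.proj u)) := by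
    simp [toCovector, soldering]
    rfl
  rw [h]
  exact (S.frame u).apply_symm_apply _

/-- In coordinates `ϑ` is `A⁻¹ ∘ Dπ`, where `A` is the coordinate expression of the frame. `A` is
smooth because `P` maps smoothly into the frame bundle, and inversion of invertible operators on a
complete space is smooth. -/
theorem isSmooth_soldering [CompleteSpace E] : IsSmooth S.soldering := by
  intro u₀ y hy
  refine ContDiffAt.contDiffWithinAt ?_
  set φ := extChartAt 𝓘(ℝ, EP) u₀ with hφ
  -- The chart on `M` is centred at the image of the point under study, since `π` need not send the
  -- whole chart at `u₀` into one chart at `π(u₀)`.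
  set u₁ : P := φ.symm y with hu₁
  set ψ := extChartAt 𝓘(ℝ, E) (S.proj u₁) with hψ
  have hA := (contMDiffAt_hom_bundle _).1 (S.contMDiff_toFrame u₁)
  have hA2 := hA.2.comp y (contMDiffAt_chart_symm hy)
  rw [contMDiffAt_iff_contDiffAt] at hA2
  have hz₀ : S.proj u₁ ∈ ψ.source := mem_extChartAt_source _
  have hB : ContDiffAt ℝ ∞ (fderiv ℝ (ψ ∘ S.proj ∘ φ.symm)) y :=
    (contDiffAt_writtenInCharts (S.contMDiff_proj u₁) hy rfl hz₀).fderiv_right (by simp)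
  let L : ∀ x (hx : x ∈ ψ.source), E ≃L[ℝ] E := fun x hx => chartDifferential (S.proj u₁) x hx
  let fr : ∀ u : P, E ≃L[ℝ] E := fun u => S.frame u
  -- Exhibiting `A` as an equivalence, the frame followed by the tangent map of `ψ`, makes
  -- `ContinuousLinearMap.inverse` a genuine inverse and not its default value.
  have hAeq : ∀ v (hv : S.proj v ∈ ψ.source), ContinuousLinearMap.inCoordinates E
      (Bundle.Trivial M E) E (TangentSpace 𝓘(ℝ, E)) (S.proj u₁) (S.proj v) (S.proj u₁) (S.proj v)
        (S.toFrame v).2 = ((fr v).trans (L (S.proj v) hv) : E →L[ℝ] E) := by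
    intro v hv
    have h3 := TangentBundle.continuousLinearMapAt_trivializationAt (I := 𝓘(ℝ, E))
      (x₀ := S.proj u₁) (x := S.proj v) (by simpa [hψ] using hv)
    ext w
    simp only [ContinuousLinearMap.inCoordinates]
    rw [h3]
    simp
    rfl
  have hnear : ∀ᶠ z in 𝓝 y, z ∈ φ.target ∧ S.proj (φ.symm z) ∈ ψ.source := by
    refine Filter.Eventually.and ((isOpen_extChartAt_target (I := 𝓘(ℝ, EP)) u₀).mem_nhds hy) ?_
    exact ((S.contMDiff_proj u₁).continuousAt.comp
      (contMDiffAt_chart_symm hy).continuousAt).preimage_mem_nhds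
      (extChartAt_source_mem_nhds (S.proj u₁))
  have hinv : ContDiffAt ℝ ∞ (fun z => ContinuousLinearMap.inverse
      (ContinuousLinearMap.inCoordinates E (Bundle.Trivial M E) E (TangentSpace 𝓘(ℝ, E))
        (S.proj u₁) (S.proj (φ.symm z)) (S.proj u₁) (S.proj (φ.symm z))
        (S.toFrame (φ.symm z)).2)) y := by
    have h1 := contDiffAt_map_inverse (𝕜 := ℝ) (n := ∞) ((fr u₁).trans (L (S.proj u₁) hz₀))
    rw [← hAeq u₁ hz₀] at h1
    exact h1.comp y hA2
  have hO : ContDiff ℝ ∞ fun T : EP →L[ℝ] E =>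
      (ContinuousAlternatingMap.ofSubsingletonLIE (𝕜 := ℝ) (E := EP) (F := E) (0 : Fin 1)) T :=
    LinearIsometryEquiv.contDiff _
  refine (hO.contDiffAt.comp y (hinv.clm_comp hB)).congr_of_eventuallyEq ?_
  filter_upwards [hnear] with z hz
  refine ext_one_form fun w => ?_
  simp only [Function.comp_apply]
  rw [hAeq _ hz.2, ContinuousLinearMap.inverse_equiv,
    fderiv_writtenInCharts (S.contMDiff_proj.mdifferentiable (by simp) _) hz.1 hz.2]
  -- The tangent map of `ψ` occurs in `Dπ` and, inverted, in `A⁻¹`; the two cancel and leave `u⁻¹ ∘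
  -- π_*`.
  have hL := (L _ hz.2).symm_apply_apply (differential (E := EP) (E' := E) S.proj (φ.symm z)
    (differential (E := EP) (E' := EP) φ.symm z w))
  have hL' := congrArg (fr (φ.symm z)).symm hL
  simp only [inChart, ContinuousAlternatingMap.compContinuousLinearMap_apply]
  refine Eq.trans ?_ hL'.symm
  rfl

/-- The fundamental vector fields are vertical. -/
theorem mfderiv_proj_fundamental [CompleteSpace E] (u : P) (A : lieAlgebra G) :
    mfderiv 𝓘(ℝ, EP) 𝓘(ℝ, E) S.proj u (S.fundamental u A) = (0 : E) := by
  have h1 := mfderiv_comp u (fst_smooth.mdifferentiable (by simp) (S.toFrame u))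
    (S.contMDiff_toFrame.mdifferentiable (by simp) u)
  let Fu : E →L[ℝ] E := (S.frame u : E →L[ℝ] TangentSpace 𝓘(ℝ, E) (S.proj u))
  have h2 := mfderiv_comp Fu (fst_smooth.mdifferentiable (by simp) (⟨S.proj u, Fu⟩ : FrameSpace E M))
    ((fibreInclusion_smooth (S.proj u)).mdifferentiable (by simp) Fu)
  -- In the frame bundle the fundamental vector is tangent to the fibre inclusion `T ↦ (π u, T)`,
  -- and the bundle projection is constant along it.
  have h3 : (fun p : FrameSpace E M => p.1) ∘ (fun T : E →L[ℝ] E => (⟨S.proj u, T⟩ : FrameSpace E M))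
      = fun _ => S.proj u := rfl
  rw [h3, mfderiv_const] at h2
  have h4 := congrArg (fun T : EP →L[ℝ] E => T (S.fundamental u A)) h1
  refine h4.trans ?_
  have h5 := congrArg (fun T : (E →L[ℝ] E) →L[ℝ] E => T (Fu ∘L (A : E →L[ℝ] E))) h2
  refine Eq.trans ?_ h5.symm
  exact congrArg (fun w : E × (E →L[ℝ] E) => (mfderiv (𝓘(ℝ, E).prod 𝓘(ℝ, E →L[ℝ] E)) 𝓘(ℝ, E)
    (fun p : FrameSpace E M => p.1) (S.toFrame u) : E × (E →L[ℝ] E) →L[ℝ] E) w)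
    (S.mfderiv_toFrame_fundamental u A)

theorem proj_surjective : Function.Surjective S.proj := fun x => by
  obtain ⟨U, _, hx, s, _, hs⟩ := S.exists_section x
  exact ⟨s x, hs x hx⟩

/-- `π` is a surjective submersion, so every tuple of tangent vectors of `M` lifts to `P`. This
brings vanishing on `P` down to `M`. -/
theorem pullback_proj_injective {F : Type*} [NormedAddCommGroup F] [NormedSpace ℝ F] {k : ℕ}
    {β γ : DiffForm E M k F}
    (h : pullback (E' := EP) S.proj β = pullback S.proj γ) : β = γ := by
  funext x
  obtain ⟨u, rfl⟩ := S.proj_surjective x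
  ext v
  choose w hw using fun i => S.differential_proj_surjective u (v i)
  have h1 := congrArg (fun η : EP [⋀^Fin k]→L[ℝ] F => η w) (congrFun h u)
  simp only [pullback, ContinuousAlternatingMap.compContinuousLinearMap_apply] at h1
  have hv : (fun i => differential (E := EP) (E' := E) S.proj u (w i)) = v := funext hw
  exact hv ▸ h1

namespace EhresmannConnection

variable {S} [CompleteSpace E] (conn : S.EhresmannConnection) [FiniteDimensional ℝ EP]

/-- The projection subtracts a fundamental vector, which is vertical. -/
theorem differential_proj_horizontal (u : P) (X : EP) :
    differential (E := EP) (E' := E) S.proj u (conn.horizontal u X) =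
      differential (E := EP) (E' := E) S.proj u X := by
  have h : conn.horizontal u X =
      X - S.fundamental u ⟨toCovector conn.form u X, conn.mem u X⟩ := rfl
  rw [h, map_sub]
  have := S.mfderiv_proj_fundamental u ⟨toCovector conn.form u X, conn.mem u X⟩
  exact (congrArg (fun w : E => differential (E := EP) (E' := E) S.proj u X - w) this).trans
    (sub_zero _)

theorem differential_proj_horizontalLift (Y : M → E) (u : P) :
    differential (E := EP) (E' := E) S.proj u (conn.horizontalLift Y u) = Y (S.proj u) := by
  rw [horizontalLift, differential_proj_horizontal]
  exact (S.differential_proj_surjective u (Y (S.proj u))).choose_spec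

/-- A pulled-back form sees a vector of `P` only through `π_*`, so the preimage chosen for the lift
is immaterial. -/
theorem interior_horizontalLift_pullback {F : Type*} [NormedAddCommGroup F] [NormedSpace ℝ F]
    {k : ℕ} (Y : M → E) (β : DiffForm E M (k + 1) F) :
    interior (conn.horizontalLift Y) (pullback S.proj β) = pullback S.proj (interior Y β) := by
  funext u
  ext v
  have h := conn.differential_proj_horizontalLift Y u
  change β (S.proj u) (fun i => differential (E := EP) (E' := E) S.proj u
      (Matrix.vecCons (conn.horizontalLift Y u) v i)) =
    β (S.proj u) (Matrix.vecCons (Y (S.proj u))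
      (fun i => differential (E := EP) (E' := E) S.proj u (v i)))
  congr 1
  funext i
  exact Fin.cases h (fun _ => rfl) i

/-- On basic forms the covariant derivative is the exterior derivative. -/
theorem covariantDerivative_pullback {F : Type*} [NormedAddCommGroup F] [NormedSpace ℝ F]
    {k : ℕ} {β : DiffForm E M k F} (hβ : IsSmooth β) :
    conn.covariantDerivative (pullback S.proj β) = pullback S.proj (extD β) := by
  funext u
  rw [covariantDerivative, extD_pullback hβ S.contMDiff_proj]
  ext v
  change extD β (S.proj u) (fun i => differential (E := EP) (E' := E) S.proj u
      (conn.horizontal u (v i))) =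
    extD β (S.proj u) (fun i => differential (E := EP) (E' := E) S.proj u (v i))
  simp only [differential_proj_horizontal]

end EhresmannConnection

end GStructure

end Frames

/-! ### Clock component of the torsion and the canonical form `ι_Z dτ` -/

section Clock

variable {d : ℕ} {M : Type*} [TopologicalSpace M] [ChartedSpace (Model d) M]
  [IsManifold 𝓘(ℝ, Model d) ∞ M]
  {EP P : Type*} [NormedAddCommGroup EP] [NormedSpace ℝ EP] [FiniteDimensional ℝ EP]
  [TopologicalSpace P] [ChartedSpace EP P] [IsManifold 𝓘(ℝ, EP) ∞ P]

/-- The first coordinate of the model space. -/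
noncomputable def clockCoord (d : ℕ) : Model d →L[ℝ] ℝ := EuclideanSpace.proj 0

theorem clockCoord_apply (v : Model d) : clockCoord d v = v 0 := rfl

/-- The Lie algebra of the Aristotelian group annihilates the first coordinate. -/
theorem lieAlgebra_aristotelianGroup_apply_zero {B : Model d →L[ℝ] Model d}
    (hB : B ∈ lieAlgebra (aristotelianGroup d)) (v : Model d) : B v 0 = 0 := by
  -- The first coordinate of `exp (t B) v` is constant in `t`, because the group preserves it; its
  -- derivative at `t = 0` is the first coordinate of `B v`.
  have h1 : HasDerivAt (fun t : ℝ => (expUnit (t • B) : Model d →L[ℝ] Model d) v 0) (B v 0) 0 :=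
    ((clockCoord d).hasFDerivAt.comp_hasDerivAt (0 : ℝ)
      (((ContinuousLinearMap.apply ℝ (Model d) v).hasFDerivAt).comp_hasDerivAt (0 : ℝ)
        (hasDerivAt_expUnit B)))
  have h2 : (fun t : ℝ => (expUnit (t • B) : Model d →L[ℝ] Model d) v 0) = fun _ => v 0 := by
    funext t
    obtain ⟨O, _, hO⟩ := hB t
    exact (hO v).1
  rw [h2] at h1
  exact h1.unique (hasDerivAt_const _ _)

namespace AristotelianStructure

variable (A : AristotelianStructure d M) {S : GStructure (EP := EP) M P (aristotelianGroup d)}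

theorem clockTorsion_apply (hS : A.IsInducedBy S) (conn : S.EhresmannConnection) (u : P)
    (v : Fin 2 → EP) : A.clockTorsion conn u v = conn.torsion u v 0 :=
  hS.τ_eq u (conn.torsion u v)

/-- The clock component of the torsion is the pullback of `dτ`. -/
theorem clockTorsion_eq_pullback (hS : A.IsInducedBy S) (conn : S.EhresmannConnection) :
    A.clockTorsion conn = pullback S.proj (extD A.τ) := by
  -- With `u (ϑ X) = π_* X` and `τ ∘ u = η`, the first component of `ϑ` is `π^* τ`.
  have h1 : (fun u => (clockCoord d).compContinuousAlternatingMap (S.soldering u)) =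
      pullback S.proj A.τ := by
    funext u
    refine ext_one_form fun X => ?_
    have h := hS.τ_eq u (toCovector S.soldering u X)
    rw [S.toCovector_soldering] at h
    have h' := (toCovector_apply A.τ (S.proj u) _).symm.trans h
    rw [toCovector_apply] at h'
    exact h'.symm
  have h2 := extD_compContinuousAlternatingMap (clockCoord d) S.isSmooth_soldering
  rw [h1, extD_pullback A.smooth_τ S.contMDiff_proj] at h2
  funext u
  ext v
  rw [A.clockTorsion_apply hS, h2, GStructure.EhresmannConnection.torsion]
  -- Each summand is a value of `ω` applied to a vector, so it has zero first coordinate.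
  have h3 : wedgeWith (ContinuousLinearMap.id ℝ (Model d →L[ℝ] Model d)) conn.form S.soldering u v 0
      = 0 := by
    rw [wedgeWith_apply, ← clockCoord_apply, map_sum]
    refine Finset.sum_eq_zero fun i _ => ?_
    have h4 := lieAlgebra_aristotelianGroup_apply_zero (conn.mem u (v i))
      (S.soldering u (i.removeNth v))
    rw [toCovector_apply] at h4
    rw [← Int.cast_smul_eq_zsmul ℝ, map_smul]
    exact (congrArg _ h4).trans (smul_zero _)
  change extD S.soldering u v 0 + wedgeWith (ContinuousLinearMap.id ℝ (Model d →L[ℝ] Model d))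
    conn.form S.soldering u v 0 = _
  rw [h3, add_zero]
  rfl

theorem isSmooth_interior_extD : IsSmooth (interior A.Z (extD A.τ)) :=
  A.smooth_τ.extD.interior A.smooth_Z

/-- Contract `τ ∧ dτ = 0` with `Z`: since `τ(Z) = 1`, this reads `dτ - τ ∧ ι_Z dτ = 0`. -/
theorem extD_eq_wedge_interior (hA : A.IsIntegrable) :
    extD A.τ = wedge A.τ (interior A.Z (extD A.τ)) := by
  funext x
  ext v
  let Z : M → Model d := A.Z
  change _ = wedge A.τ (interior Z (extD A.τ)) x v
  rw [eq_vec_two v, wedge_one_apply, toCovector_interior, toCovector_interior]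
  have h : wedge A.τ (extD A.τ) x ![Z x, v 0, v 1] = 0 :=
    congrArg (fun η : Model d [⋀^Fin 3]→L[ℝ] ℝ => η ![Z x, v 0, v 1]) (congrFun hA x)
  have hZ : toCovector A.τ x (Z x) = 1 := A.τ_Z x
  rw [wedge_two_apply, hZ] at h
  linarith

theorem isGodbillonVeyForm_interior (hA : A.IsIntegrable) :
    IsGodbillonVeyForm A.τ (interior A.Z (extD A.τ)) where
  smooth_form := A.smooth_τ
  ne_zero x h := by
    have h1 := (toCovector_apply A.τ x _).symm.trans (A.τ_Z x)
    rw [h] at h1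
    exact zero_ne_one h1
  smooth := A.isSmooth_interior_extD
  extD_eq := A.extD_eq_wedge_interior hA

/-- Contracting `dτ = τ ∧ α` with `Z` gives `ι_Z dτ = τ(Z) α - α(Z) τ`, which is `α`. -/
theorem eq_interior_extD {α : DiffForm (Model d) M 1 ℝ} (h : IsGodbillonVeyForm A.τ α)
    (hZ : interior A.Z α = 0) : α = interior A.Z (extD A.τ) := by
  funext x
  refine ext_one_form fun v => ?_
  let Z : M → Model d := A.Z
  have h0 : toCovector α x (Z x) = 0 := by
    have := congrArg (fun η : Model d [⋀^Fin 0]→L[ℝ] ℝ => η ![]) (congrFun hZ x)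
    rw [toCovector_apply, const_eq]
    exact this
  have h1 : toCovector A.τ x (Z x) = 1 := A.τ_Z x
  change _ = interior Z (extD A.τ) x fun _ => v
  rw [← toCovector_apply, ← toCovector_apply, toCovector_interior, h.extD_eq, wedge_one_apply,
    h0, h1]
  ring

theorem interior_interior_extD : interior A.Z (interior A.Z (extD A.τ)) = 0 := by
  funext x
  ext v
  exact (extD A.τ x).map_eq_zero_of_eq _ (i := 0) (j := 1) rfl (by decide)

theorem observedTorsion_eq_pullback (hS : A.IsInducedBy S) (conn : S.EhresmannConnection) :
    A.observedTorsion conn = pullback S.proj (interior A.Z (extD A.τ)) := by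
  rw [observedTorsion, A.clockTorsion_eq_pullback hS]
  exact conn.interior_horizontalLift_pullback A.Z _

/-! ### Closedness of `τ` and vanishing of the Godbillon-Vey class -/

theorem extD_eq_zero_of_clockTorsion (hS : A.IsInducedBy S) (conn : S.EhresmannConnection)
    (h : A.clockTorsion conn = 0) : extD A.τ = 0 := by
  apply S.pullback_proj_injective
  rw [← A.clockTorsion_eq_pullback hS conn, h]
  rfl

theorem extD_eq_zero_of_torsion (hS : A.IsInducedBy S) (conn : S.EhresmannConnection)
    (h : conn.torsion = 0) : extD A.τ = 0 := by
  refine A.extD_eq_zero_of_clockTorsion hS conn ?_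
  funext u
  ext v
  rw [A.clockTorsion_apply hS, h]
  rfl

/-- Every `∂κ` takes values in the span of the images of Lie algebra elements, hence in the kernel
of the first coordinate. -/
theorem clockTorsion_eq_zero_of_intrinsicTorsionVanishes (hS : A.IsInducedBy S)
    (conn : S.EhresmannConnection) (h : conn.IntrinsicTorsionVanishes) :
    A.clockTorsion conn = 0 := by
  funext u
  ext v
  obtain ⟨κ, hκ, h⟩ := h u
  rw [A.clockTorsion_apply hS, eq_vec_two v, h]
  have h1 := lieAlgebra_aristotelianGroup_apply_zero (hκ (toCovector S.soldering u (v 0)))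
    (toCovector S.soldering u (v 1))
  have h2 := lieAlgebra_aristotelianGroup_apply_zero (hκ (toCovector S.soldering u (v 1)))
    (toCovector S.soldering u (v 0))
  simp [h1, h2]

/-- For closed `τ` the Godbillon-Vey form of any `α` vanishes. -/
theorem wedge_extD_eq_zero (h0 : extD A.τ = 0) {α : DiffForm (Model d) M 1 ℝ}
    (h : IsGodbillonVeyForm A.τ α) : wedge α (extD α) = 0 := by
  have h1 : wedge A.τ α = 0 := h.extD_eq ▸ h0
  -- Differentiating `τ ∧ α = 0` with `dτ = 0` leaves `τ ∧ dα = 0`.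
  have h2 := extD_wedge_one h.smooth_form h.smooth
  rw [h1, extD_zero, h0] at h2
  let Z : M → Model d := A.Z
  -- Contracting `τ ∧ α = 0` with `Z` gives `α = α(Z) τ`. The function `α(Z)` is never
  -- differentiated.
  have h3 : ∀ x v, toCovector α x v = toCovector α x (Z x) * toCovector A.τ x v := by
    intro x v
    have h4 : wedge A.τ α x ![Z x, v] = 0 :=
      congrArg (fun η : Model d [⋀^Fin 2]→L[ℝ] ℝ => η ![Z x, v]) (congrFun h1 x)
    have h5 : toCovector A.τ x (Z x) = 1 := A.τ_Z x
    rw [wedge_one_apply, h5] at h4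
    linarith
  funext x
  ext v
  have hv : v = ![v 0, v 1, v 2] := by ext i; fin_cases i <;> rfl
  have h6 : wedge α (0 : DiffForm (Model d) M 2 ℝ) x ![v 0, v 1, v 2] = 0 := by
    rw [wedge_two_apply]
    simp
  have h4 : 0 = wedge α 0 x ![v 0, v 1, v 2] - wedge A.τ (extD α) x ![v 0, v 1, v 2] :=
    congrArg (fun η : Model d [⋀^Fin 3]→L[ℝ] ℝ => η ![v 0, v 1, v 2]) (congrFun h2 x)
  rw [h6, wedge_two_apply] at h4
  rw [hv, wedge_two_apply, h3 x (v 0), h3 x (v 1), h3 x (v 2)]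
  change _ = (0 : ℝ)
  linear_combination toCovector α x (Z x) * h4

theorem godbillonVeyClass_eq_zero (h0 : extD A.τ = 0) {α : DiffForm (Model d) M 1 ℝ}
    (h : IsGodbillonVeyForm A.τ α) : godbillonVeyClass h = 0 := by
  have h1 : (⟨wedge α (extD α), h.mem_closedForms⟩ : closedForms (Model d) M 3) = 0 :=
    Subtype.ext (A.wedge_extD_eq_zero h0 h)
  rw [godbillonVeyClass, h1]
  exact Submodule.Quotient.mk_zero _

/-- The clock form of an integrable `G`-structure is closed: it is constant in adapted charts. -/
theorem extD_eq_zero_of_isIntegrable (hS : A.IsInducedBy S) (h : S.IsIntegrable) :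
    extD A.τ = 0 := by
  funext x
  obtain ⟨e, he, hx, hf⟩ := h x
  -- The constant form `η` on the model space, to which `τ` corresponds in adapted charts.
  let c : DiffForm (Model d) (Model d) 1 ℝ := fun _ =>
    ContinuousAlternatingMap.ofSubsingletonLIE (0 : Fin 1)
      (clockCoord d)
  have hcc : ∀ x₀, inChart c x₀ = c := by
    intro x₀
    funext y
    refine ext_one_form fun v => ?_
    have h1 : differential (E := Model d) (E' := Model d)
        (extChartAt 𝓘(ℝ, Model d) x₀).symm y = ContinuousLinearMap.id ℝ (Model d) := by
      rw [extChartAt_model_space_eq_id]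
      exact mfderiv_id
    rw [inChart, h1]
    rfl
  have hc : IsSmooth c := fun x₀ => by
    rw [hcc]; exact contDiffOn_const
  have hdc : extD c = 0 := by
    funext y
    have h1 : extDeriv c y = 0 := by
      ext v
      have h2 : fderiv ℝ c y = 0 := by simp [c]
      simp [extDeriv, h2, ContinuousAlternatingMap.alternatizeUncurryFin_apply]
    rw [extD, hcc, extChartAt_model_space_eq_id]
    change (extDeriv c y).compContinuousLinearMap _ = 0
    rw [h1]
    rfl
  have he1 : ContMDiffOn 𝓘(ℝ, Model d) 𝓘(ℝ, Model d) ∞ e e.source :=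
    contMDiffOn_of_mem_maximalAtlas he
  have he2 : ContMDiffOn 𝓘(ℝ, Model d) 𝓘(ℝ, Model d) ∞ e.symm e.target :=
    contMDiffOn_symm_of_mem_maximalAtlas he
  -- The coordinate frame of `e` is a frame of `P`, so `τ(w)` is the first coordinate of `e_* w`.
  -- This holds only on the domain of `e`, which is why naturality is needed for germs.
  have key : A.τ =ᶠ[𝓝 x] pullback e c := by
    filter_upwards [e.open_source.mem_nhds hx] with y hy
    obtain ⟨u, rfl, hu⟩ := hf y hy
    refine ext_one_form fun w => ?_
    have hd1 : MDifferentiableAt 𝓘(ℝ, Model d) 𝓘(ℝ, Model d) e (S.proj u) :=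
      (he1.contMDiffAt (e.open_source.mem_nhds hy)).mdifferentiableAt (by simp)
    have hd2 : MDifferentiableAt 𝓘(ℝ, Model d) 𝓘(ℝ, Model d) e.symm (e (S.proj u)) :=
      (he2.contMDiffAt (e.open_target.mem_nhds (e.map_source hy))).mdifferentiableAt (by simp)
    have h1 := mfderiv_comp (S.proj u) hd2 hd1
    have h2 : e.symm ∘ e =ᶠ[𝓝 (S.proj u)] id := by
      filter_upwards [e.open_source.mem_nhds hy] with z hz
      exact e.left_inv hz
    rw [h2.mfderiv_eq, mfderiv_id] at h1
    set v : Model d := differential (E := Model d) (E' := Model d) e (S.proj u) w with hv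
    have h3 : w = S.frame u v := by
      refine (congrArg (fun T : Model d →L[ℝ] Model d => T w) h1).trans ?_
      exact (hu v).symm
    have h4 := (toCovector_apply A.τ (S.proj u) _).symm.trans (hS.τ_eq u v)
    exact (congrArg (fun w' : Model d => A.τ (S.proj u) fun _ => w') h3).trans h4
  have h5 := extD_eq_pullback_extD hc (he1.contMDiffAt (e.open_source.mem_nhds hx)) key
  rw [h5, hdc]
  rfl

end AristotelianStructure

end Clock

end GodbillonVey

theorem mainTheorem3 (d : ℕ) {M : Type*} [TopologicalSpace M] [ChartedSpace (Model d) M]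
    [IsManifold 𝓘(ℝ, Model d) ∞ M]
    {EP P : Type*} [NormedAddCommGroup EP] [NormedSpace ℝ EP] [FiniteDimensional ℝ EP]
    [TopologicalSpace P] [ChartedSpace EP P] [IsManifold 𝓘(ℝ, EP) ∞ P]
    (A : AristotelianStructure d M) (hA : A.IsIntegrable)
    (S : GStructure (EP := EP) M P (aristotelianGroup d)) (hS : A.IsInducedBy S)
    (conn : S.EhresmannConnection) :
    (∃! α : DiffForm (Model d) M 1 ℝ, IsGodbillonVeyForm A.τ α ∧ GodbillonVey.interior A.Z α = 0) ∧
    (∀ α : DiffForm (Model d) M 1 ℝ, IsGodbillonVeyForm A.τ α → GodbillonVey.interior A.Z α = 0 →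
      pullback S.proj (wedge α (extD α)) =
        wedge (A.observedTorsion conn) (conn.covariantDerivative (A.observedTorsion conn))) ∧
    (conn.torsion = 0 →
      ∀ (α : DiffForm (Model d) M 1 ℝ) (h : IsGodbillonVeyForm A.τ α),
        godbillonVeyClass h = 0) ∧
    (conn.IntrinsicTorsionVanishes →
      ∀ (α : DiffForm (Model d) M 1 ℝ) (h : IsGodbillonVeyForm A.τ α),
        godbillonVeyClass h = 0) ∧
    (∀ (α : DiffForm (Model d) M 1 ℝ) (h : IsGodbillonVeyForm A.τ α),
      godbillonVeyClass h ≠ 0 →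
        conn.torsion ≠ 0 ∧ ¬ conn.IntrinsicTorsionVanishes ∧ ¬ S.IsIntegrable) := by
  refine ⟨⟨GodbillonVey.interior A.Z (extD A.τ),
    ⟨A.isGodbillonVeyForm_interior hA, A.interior_interior_extD⟩,
    fun β hβ => A.eq_interior_extD hβ.1 hβ.2⟩, fun α h hZ => ?_, fun hT α h => ?_, fun hT α h => ?_,
    fun α h hne => ⟨fun hT => hne ?_, fun hT => hne ?_, fun hI => hne ?_⟩⟩
  -- Uniqueness identifies `ι_Z dτ` with the given `α`, so `ι_{Z̄} Θ̄ = π^* α`.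
  · rw [A.observedTorsion_eq_pullback hS, ← A.eq_interior_extD h hZ,
      conn.covariantDerivative_pullback h.smooth, pullback_wedge]
  · exact A.godbillonVeyClass_eq_zero (A.extD_eq_zero_of_torsion hS conn hT) h
  · exact A.godbillonVeyClass_eq_zero (A.extD_eq_zero_of_clockTorsion hS conn
      (A.clockTorsion_eq_zero_of_intrinsicTorsionVanishes hS conn hT)) h
  · exact A.godbillonVeyClass_eq_zero (A.extD_eq_zero_of_torsion hS conn hT) h
  · exact A.godbillonVeyClass_eq_zero (A.extD_eq_zero_of_clockTorsion hS conn
      (A.clockTorsion_eq_zero_of_intrinsicTorsionVanishes hS conn hT)) h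
  · exact A.godbillonVeyClass_eq_zero (A.extD_eq_zero_of_isIntegrable hS hI) h
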